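/- Consider $n$ homogeneous hard balls in $\mathbb R^3$ with radii $R_1,\dots,R_n>0$ and masses $M_1,\dots,M_n>0$, whose centres move along paths $a_i\colon I\to\mathbb R^3$ during an open (possibly unbounded) time interval $I$. The balls never overlap: $|a_i(t)-a_j(t)|\ge R_i+R_j$ for all $t\in I$ and $i\ne j$. Every ball moves along a straight line with constant speed until two balls collide; more precisely, for every $t\in I$ all balls have constant velocities $u_1,\dots,u_n$ on some interval $(t-\varepsilon,t]$ and constant velocities $w_1,\dots,w_n$ on some interval $[t,t+\varepsilon)$, and either $w_k=u_k$ for all $k$, or there are two balls $i\neq j$ that touch at time $t$, that is, $|a_i(t)-a_j(t)|=R_i+R_j$, and collide elastically: $w_k=u_k$ for $k\ne i,j$, the momentum is preserved, $M_iw_i+M_jw_j=M_iu_i+M_ju_j$, the kinetic energy is preserved, $\tfrac12M_i|w_i|^2+\tfrac12M_j|w_j|^2=\tfrac12M_i|u_i|^2+\tfrac12M_j|u_j|^2$, and $w_i-u_i$ is parallel to the line through the two centres. (So only pairwise collisions occur.) A collision is a triple $(t,i,j)$ with $t\in I$ and $i<j$ such that the balls $i$ and $j$ touch at time $t$ and have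 different velocities $u_i\ne u_j$ just before $t$ (so grazing contacts are counted as well). Then the total number of collisions of any such motion cannot exceed some number $N$ that depends only on the radii $R_1,\dots,R_n$ and the masses $M_1,\dots,M_n$ (in particular, neither on $I$ nor on the initial positions and velocities). If the balls are identical, that is, all radii are equal and all masses are equal, then $N$ can be chosen to depend only on $n$. -/

import Mathlib

open Filter Topology

namespace HardBalls

/-- Physical space `ℝ³` with its Euclidean norm. -/
abbrev Space : Type := EuclideanSpace ℝ (Fin 3)

/-- The configuration `a` of `n` balls (given by their centres) moves along a straight line with
constant velocities `u` during some time interval `(t - ε, t]`. -/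
def VelBefore {n : ℕ} (a : ℝ → Fin n → Space) (t : ℝ) (u : Fin n → Space) : Prop :=
  ∀ᶠ s in 𝓝[<] t, ∀ i, a s i = a t i + (s - t) • u i

/-- The configuration `a` of `n` balls moves along a straight line with constant velocities `w`
during some time interval `[t, t + ε)`. -/
def VelAfter {n : ℕ} (a : ℝ → Fin n → Space) (t : ℝ) (w : Fin n → Space) : Prop :=
  ∀ᶠ s in 𝓝[>] t, ∀ i, a s i = a t i + (s - t) • w i

/-- In the configuration `x` the distinct balls `i` and `j` of radii `R i` and `R j` touch. -/
def Touch {n : ℕ} (R : Fin n → ℝ) (x : Fin n → Space) (i j : Fin n) : Prop :=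
  i ≠ j ∧ dist (x i) (x j) = R i + R j

/-- The laws of classical mechanics for an elastic collision of the (frictionless, homogeneous)
balls `i` and `j` of masses `M i` and `M j` in the configuration `x`, with velocities `u` before
and `w` after: the other balls are unaffected, the total momentum and the kinetic energy of the
two balls are preserved, and the impulse acts along the line through the two centres. -/
structure ElasticLaw {n : ℕ} (M : Fin n → ℝ) (x : Fin n → Space) (i j : Fin n)
    (u w : Fin n → Space) : Prop where
  others : ∀ k, k ≠ i → k ≠ j → w k = u k
  momentum : M i • w i + M j • w j = M i • u i + M j • u j
  energy : M i / 2 * ‖w i‖ ^ 2 + M j / 2 * ‖w j‖ ^ 2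
    = M i / 2 * ‖u i‖ ^ 2 + M j / 2 * ‖u j‖ ^ 2
  normal : ∃ c : ℝ, w i - u i = c • (x i - x j)

/-- `a` describes, during the open time interval `I` (possibly unbounded), the motion of the
centres of `n` hard balls of radii `R i` and masses `M i`. The balls never overlap. Around every
instant the balls move with constant velocities `u` before it and `w` after it; either no velocity
changes at this instant, or exactly one touching pair of balls collides elastically (only pairwise
collisions change velocities). -/
structure IsMotion {n : ℕ} (R M : Fin n → ℝ) (I : Set ℝ) (a : ℝ → Fin n → Space) : Prop where
  isOpen : IsOpen I
  ordConnected : I.OrdConnected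
  hard : ∀ t ∈ I, ∀ i j, i ≠ j → R i + R j ≤ dist (a t i) (a t j)
  law : ∀ t ∈ I, ∃ u w : Fin n → Space, VelBefore a t u ∧ VelAfter a t w ∧
    (w = u ∨ ∃ i j, Touch R (a t) i j ∧ ElasticLaw M (a t) i j u w)

/-- The collisions during `I`: all `(t, i, j)` with `i < j` such that the balls `i` and `j` touch
at the time `t`, having moved with different velocities right before `t`. Every change of velocities
is such an event, and so is a grazing contact; two balls that travel side by side in
permanent contact, without relative motion, do not collide. -/
def collisions {n : ℕ} (R : Fin n → ℝ) (I : Set ℝ) (a : ℝ → Fin n → Space) :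
    Set (ℝ × Fin n × Fin n) :=
  {p | p.1 ∈ I ∧ p.2.1 < p.2.2 ∧ Touch R (a p.1) p.2.1 p.2.2 ∧
    ∃ u, VelBefore a p.1 u ∧ u p.2.1 ≠ u p.2.2}

end HardBalls

/-! In configuration space with the mass metric, a motion is a path `X` of constant speed `√c` that
is deflected by convex walls, one for each pair of balls. If `z` lies in all walls of colliding
pairs, every deflection turns `X` away from `z`, so `|X - z|² - cτ²` is convex
(`IsMotion.exists_speed`). The walls are uniformly nondegenerate (`nondegenerate_wall`): a point
near several of them is near their intersection, because contracting clusters of balls slightly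
makes every near-contact a contact.

The straightness of `X` is measured by its excess, the variance of its velocity integrated over
time. Suppose `[p, q]`, with `r` inside, has small excess, and `X` visits all walls on either side
of `r` within it. Then `X r` is close to every wall, hence to some `z` in their intersection, and
convexity shows that, for any larger interval, almost all of its excess is produced by one corner at
`r` (`excess_add_le_sqrt`). Among many visits, pigeonhole yields two such corners that are well
separated in time. They cannot both carry almost all of the excess unless it vanishes
(`SpeedLE.excess_eq_zero_of_corners`), so `X` is straight on a stretch during which all pairs
collide at least twice. This is absurd: in uniform motion two balls collide at most once.

The bound follows by induction on the number of colliding pairs: with too many collision times, the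
interval splits into many blocks in each of which all of these pairs collide. -/

namespace HardBalls

/-! ### Excess of a path and convex sets that it visits repeatedly -/

section Excess

variable {H : Type*} [NormedAddCommGroup H]

/-- For a path of constant squared speed `c`, the integral over `[s, t]` of the squared distance
of the velocity to its mean. -/
noncomputable def excess (X : ℝ → H) (c s t : ℝ) : ℝ := c * (t - s) - ‖X t - X s‖ ^ 2 / (t - s)

theorem excess_self (X : ℝ → H) (c s : ℝ) : excess X c s s = 0 := by simp [excess]

theorem excess_nonneg {X : ℝ → H} {c s t : ℝ} (hst : s ≤ t)
    (h : ‖X t - X s‖ ^ 2 ≤ c * (t - s) ^ 2) : 0 ≤ excess X c s t := by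
  rcases hst.eq_or_lt with rfl | hlt
  · rw [excess_self]
  · have := sub_pos.2 hlt
    rw [excess, sub_nonneg, div_le_iff₀ this]
    linarith

/-- The path `X` moves at most with squared speed `c` during `I`. -/
def SpeedLE (X : ℝ → H) (c : ℝ) (I : Set ℝ) : Prop :=
  ∀ s ∈ I, ∀ t ∈ I, s ≤ t → ‖X t - X s‖ ^ 2 ≤ c * (t - s) ^ 2

theorem SpeedLE.excess_nonneg {X : ℝ → H} {c : ℝ} {I : Set ℝ} (h : SpeedLE X c I) {s t : ℝ}
    (hs : s ∈ I) (ht : t ∈ I) (hst : s ≤ t) : 0 ≤ excess X c s t :=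
  HardBalls.excess_nonneg hst (h s hs t ht hst)

variable [InnerProductSpace ℝ H]

/-- Mean velocity of the path `X` between the times `s` and `t`. -/
noncomputable def meanVel (X : ℝ → H) (s t : ℝ) : H := (t - s)⁻¹ • (X t - X s)

theorem smul_meanVel (X : ℝ → H) {s t : ℝ} (h : s < t) :
    (t - s) • meanVel X s t = X t - X s := by
  rw [meanVel, smul_smul, mul_inv_cancel₀ (sub_pos.2 h).ne', one_smul]

theorem excess_eq_of_lt (X : ℝ → H) (c : ℝ) {s t : ℝ} (h : s < t) :
    excess X c s t = (t - s) * (c - ‖meanVel X s t‖ ^ 2) := by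
  have h0 := (sub_pos.2 h).ne'
  rw [excess, ← smul_meanVel X h, norm_smul, mul_pow, Real.norm_eq_abs, sq_abs]
  field_simp

theorem smul_meanVel_add (X : ℝ → H) {s r t : ℝ} (h₁ : s < r) (h₂ : r < t) :
    (t - s) • meanVel X s t = (r - s) • meanVel X s r + (t - r) • meanVel X r t := by
  rw [smul_meanVel X (h₁.trans h₂), smul_meanVel X h₁, smul_meanVel X h₂]
  abel

theorem meanVel_eq (X : ℝ → H) {s r t : ℝ} (h₁ : s < r) (h₂ : r < t) :
    meanVel X s t
      = ((r - s) / (t - s)) • meanVel X s r + ((t - r) / (t - s)) • meanVel X r t := by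
  have h0 := (sub_pos.2 (h₁.trans h₂)).ne'
  have h := congrArg (fun v => (t - s)⁻¹ • v) (smul_meanVel_add X h₁ h₂)
  simp only [smul_smul, smul_add, inv_mul_cancel₀ h0, one_smul] at h
  rw [h, div_eq_inv_mul, div_eq_inv_mul]

/-- This is the decomposition of a variance into the parts within the two pieces and the part
between them. The last term is the contribution of a corner at `r`. -/
theorem excess_split (X : ℝ → H) (c : ℝ) {s r t : ℝ} (h₁ : s < r) (h₂ : r < t) :
    excess X c s t = excess X c s r + excess X c r t
      + (r - s) * (t - r) / (t - s) * ‖meanVel X s r - meanVel X r t‖ ^ 2 := by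
  have h3 : t - s ≠ 0 := (sub_pos.2 (h₁.trans h₂)).ne'
  rw [excess_eq_of_lt X c (h₁.trans h₂), excess_eq_of_lt X c h₁, excess_eq_of_lt X c h₂,
    meanVel_eq X h₁ h₂, norm_add_sq_real, norm_sub_sq_real, norm_smul, norm_smul, mul_pow, mul_pow,
    Real.norm_eq_abs, Real.norm_eq_abs, sq_abs, sq_abs, inner_smul_left, inner_smul_right]
  simp only [conj_trivial]
  field_simp
  ring

theorem excess_add_le (X : ℝ → H) (c : ℝ) {s r t : ℝ} (h₁ : s ≤ r) (h₂ : r ≤ t) :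
    excess X c s r + excess X c r t ≤ excess X c s t := by
  rcases h₁.eq_or_lt with rfl | h₁
  · simp [excess_self]
  rcases h₂.eq_or_lt with rfl | h₂
  · simp [excess_self]
  rw [excess_split X c h₁ h₂]
  have a := sub_pos.2 h₁
  have b := sub_pos.2 h₂
  have d := sub_pos.2 (h₁.trans h₂)
  have : 0 ≤ (r - s) * (t - r) / (t - s) * ‖meanVel X s r - meanVel X r t‖ ^ 2 := by positivity
  linarith

theorem SpeedLE.excess_mono {X : ℝ → H} {c : ℝ} {I : Set ℝ} (h : SpeedLE X c I)
    {s s' t' t : ℝ} (hs : s ∈ I) (hs' : s' ∈ I) (ht' : t' ∈ I) (ht : t ∈ I)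
    (h₁ : s ≤ s') (h₂ : s' ≤ t') (h₃ : t' ≤ t) : excess X c s' t' ≤ excess X c s t := by
  have := excess_add_le X c h₁ (h₂.trans h₃)
  have := excess_add_le X c h₂ h₃
  have := h.excess_nonneg hs hs' h₁
  have := h.excess_nonneg ht' ht h₃
  linarith

theorem SpeedLE.norm_meanVel_sub_sq_le {X : ℝ → H} {c : ℝ} {I : Set ℝ} (h : SpeedLE X c I)
    {s r t : ℝ} (hs : s ∈ I) (hr : r ∈ I) (ht : t ∈ I) (h₁ : s < r) (h₂ : r < t) :
    (r - s) * (t - r) / (t - s) * ‖meanVel X s r - meanVel X r t‖ ^ 2 ≤ excess X c s t := by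
  rw [excess_split X c h₁ h₂]
  have := h.excess_nonneg hs hr h₁.le
  have := h.excess_nonneg hr ht h₂.le
  linarith

/-- Compare the slopes of the convex function over `[s, r]` and `[r, t]`, expanding the squares
around `X r`. The terms quadratic in the mean velocities combine with `c * τ ^ 2` to the two
excesses, and the linear ones give the inner product. -/
theorem excess_add_le_inner {X : ℝ → H} {c : ℝ} {I : Set ℝ} {z : H}
    (hz : ConvexOn ℝ I fun τ => ‖X τ - z‖ ^ 2 - c * τ ^ 2) {s r t : ℝ} (hs : s ∈ I) (ht : t ∈ I)
    (h₁ : s < r) (h₂ : r < t) :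
    excess X c s r + excess X c r t
      ≤ 2 * inner ℝ (meanVel X s r - meanVel X r t) (z - X r) := by
  have a := sub_pos.2 h₁
  have b := sub_pos.2 h₂
  have key := hz.slope_mono_adjacent hs ht h₁ h₂
  have e₁ : X s - z = -((r - s) • meanVel X s r + (z - X r)) := by
    rw [smul_meanVel X h₁]; abel
  have e₂ : X r - z = -(z - X r) := by abel
  have e₃ : X t - z = (t - r) • meanVel X r t - (z - X r) := by
    rw [smul_meanVel X h₂]; abel
  rw [e₁, e₂, e₃] at key
  generalize z - X r = ζ at key ⊢
  rw [norm_neg, norm_neg, norm_add_sq_real, norm_sub_sq_real, norm_smul, norm_smul,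
    mul_pow, mul_pow, Real.norm_eq_abs, Real.norm_eq_abs, sq_abs, sq_abs, inner_smul_left,
    inner_smul_left, div_le_div_iff₀ a b] at key
  simp only [conj_trivial] at key
  rw [excess_eq_of_lt X c h₁, excess_eq_of_lt X c h₂, inner_sub_left]
  have hpos : 0 < (r - s) * (t - r) := by positivity
  refine le_of_mul_le_mul_left ?_ hpos
  linarith

/-- A convex set visited before and after the time `r` comes close to `X r`. -/
theorem SpeedLE.exists_mem_near {X : ℝ → H} {c : ℝ} {I : Set ℝ} (h : SpeedLE X c I)
    {B : Set H} (hB : Convex ℝ B)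
    {s r t : ℝ} (hs : s ∈ I) (hr : r ∈ I) (ht : t ∈ I) (h₁ : s < r) (h₂ : r < t)
    (hsB : X s ∈ B) (htB : X t ∈ B) :
    ∃ b ∈ B, ‖X r - b‖ ^ 2 ≤ (r - s) * (t - r) / (t - s) * excess X c s t := by
  have a := sub_pos.2 h₁
  have b := sub_pos.2 h₂
  have d := sub_pos.2 (h₁.trans h₂)
  -- The point reached at time `r` by the uniform motion from `X s` to `X t`. Its offset from `X r`
  -- is a multiple of the jump of the mean velocity, which the excess controls.
  refine ⟨((t - r) / (t - s)) • X s + ((r - s) / (t - s)) • X t,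
    hB hsB htB (by positivity) (by positivity) (by field_simp; ring), ?_⟩
  have e : X r - (((t - r) / (t - s)) • X s + ((r - s) / (t - s)) • X t)
      = ((r - s) * (t - r) / (t - s)) • (meanVel X s r - meanVel X r t) := by
    rw [meanVel, meanVel, smul_sub, smul_smul, smul_smul]
    have e₁ : (r - s) * (t - r) / (t - s) * (r - s)⁻¹ = (t - r) / (t - s) := by field_simp
    have e₂ : (r - s) * (t - r) / (t - s) * (t - r)⁻¹ = (r - s) / (t - s) := by field_simp
    have e₃ : X r = ((t - r) / (t - s)) • X r + ((r - s) / (t - s)) • X r := by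
      rw [← add_smul, show (t - r) / (t - s) + (r - s) / (t - s) = 1 by field_simp; ring, one_smul]
    rw [e₁, e₂]
    nth_rewrite 1 [e₃]
    rw [smul_sub, smul_sub]
    abel
  rw [e, norm_smul, mul_pow, Real.norm_eq_abs, sq_abs, sq, mul_assoc]
  exact mul_le_mul_of_nonneg_left (h.norm_meanVel_sub_sq_le hs hr ht h₁ h₂) (by positivity)

/-- The expression is `1 / (1/α + 1/β)`. It is the weight of a corner in `excess_split`, so this
compares the weights for nested intervals around the corner. -/
theorem harmonic_mono {α β A B : ℝ} (hα : 0 < α) (hβ : 0 < β) (hA : α ≤ A) (hB : β ≤ B) :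
    α * β / (α + β) ≤ A * B / (A + B) := by
  have h1 : 0 < A := hα.trans_le hA
  have h2 : 0 < B := hβ.trans_le hB
  rw [div_le_div_iff₀ (by positivity) (by positivity)]
  have := mul_nonneg (mul_nonneg hα.le h1.le) (sub_nonneg.2 hB)
  have := mul_nonneg (mul_nonneg hβ.le h2.le) (sub_nonneg.2 hA)
  nlinarith

/-- A family of sets is `C`-nondegenerate if a point close to all of them is close to their
intersection. -/
def Nondegenerate {ι : Type*} (B : ι → Set H) (C : ℝ) : Prop :=
  ∀ (y : H) (δ : ℝ), 0 ≤ δ → (∀ k, ∃ b ∈ B k, ‖y - b‖ ≤ δ) →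
    ∃ z, (∀ k, z ∈ B k) ∧ ‖z - y‖ ≤ C * δ

/-- If `[p, q]` has far smaller excess than `[a, b]`, the right side is small compared with the
excess of `[a, b]`: by `excess_split`, nearly all of it then comes from the corner at `r`. -/
theorem excess_add_le_sqrt {ι : Type*} {B : ι → Set H} {C : ℝ}
    (hnd : Nondegenerate B C) (hB : ∀ k, Convex ℝ (B k)) {X : ℝ → H} {c : ℝ} {I : Set ℝ}
    (hI : I.OrdConnected) (h : SpeedLE X c I)
    (hconv : ∀ z, (∀ k, z ∈ B k) → ConvexOn ℝ I fun τ => ‖X τ - z‖ ^ 2 - c * τ ^ 2)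
    {a p r q b : ℝ} (ha : a ∈ I) (hb : b ∈ I) (hap : a ≤ p) (hpr : p < r) (hrq : r < q)
    (hqb : q ≤ b) (hl : ∀ k, ∃ s ∈ Set.Ioo p r, X s ∈ B k) (hr : ∀ k, ∃ s ∈ Set.Ioo r q, X s ∈ B k) :
    excess X c a r + excess X c r b
      ≤ 2 * C * Real.sqrt (excess X c p q * excess X c a b) := by
  have mem : ∀ x, a ≤ x → x ≤ b → x ∈ I := fun x h₁ h₂ => hI.out ha hb ⟨h₁, h₂⟩
  have har : a < r := hap.trans_lt hpr
  have hrb : r < b := hrq.trans_le hqb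
  have hpI := mem p hap (by linarith)
  have hqI := mem q (by linarith) hqb
  have hrI := mem r har.le hrb.le
  have A0 := sub_pos.2 har
  have B0 := sub_pos.2 hrb
  have D0 := sub_pos.2 (har.trans hrb)
  -- The distance to the walls is at most `√(η * excess X c p q)` and the velocity jump at most
  -- `√(excess X c a b / η)`, so `η` cancels in the product.
  set η := (r - a) * (b - r) / (b - a) with hη
  have η0 : 0 < η := by positivity
  have E0 := h.excess_nonneg hpI hqI (hpr.trans hrq).le
  obtain ⟨z, hz, hzr⟩ := hnd (X r) (Real.sqrt (η * excess X c p q)) (Real.sqrt_nonneg _) (by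
    intro k
    obtain ⟨s, hs, hsB⟩ := hl k
    obtain ⟨t, ht, htB⟩ := hr k
    have hsI := mem s (hap.trans hs.1.le) (hs.2.le.trans hrb.le)
    have htI := mem t (har.le.trans ht.1.le) (ht.2.le.trans hqb)
    obtain ⟨y, hy, hyr⟩ := h.exists_mem_near (hB k) hsI hrI htI hs.2 ht.1 hsB htB
    refine ⟨y, hy, Real.le_sqrt_of_sq_le (hyr.trans ?_)⟩
    have m₁ := harmonic_mono (sub_pos.2 hs.2) (sub_pos.2 ht.1)
      (show r - s ≤ r - a by linarith [hs.1]) (show t - r ≤ b - r by linarith [ht.2])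
    rw [show r - s + (t - r) = t - s by ring, show r - a + (b - r) = b - a by ring] at m₁
    exact mul_le_mul m₁ (h.excess_mono hpI hsI htI hqI hs.1.le (hs.2.trans ht.1).le ht.2.le)
      (h.excess_nonneg hsI htI (hs.2.trans ht.1).le) η0.le)
  refine (excess_add_le_inner (hconv z hz) ha hb har hrb).trans ?_
  have hv := h.norm_meanVel_sub_sq_le ha hrI hb har hrb
  rw [← hη] at hv
  have hv' : ‖meanVel X a r - meanVel X r b‖ ≤ Real.sqrt (excess X c a b / η) := by
    refine Real.le_sqrt_of_sq_le ?_
    rw [le_div_iff₀ η0]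
    linarith
  have := real_inner_le_norm (meanVel X a r - meanVel X r b) (z - X r)
  have h3 := mul_le_mul hv' hzr (norm_nonneg _) (Real.sqrt_nonneg _)
  have e : Real.sqrt (excess X c a b / η) * Real.sqrt (η * excess X c p q)
      = Real.sqrt (excess X c p q * excess X c a b) := by
    rw [← Real.sqrt_mul' _ (by positivity)]
    congr 1
    field_simp
  calc _ ≤ 2 * (Real.sqrt (excess X c a b / η) * (C * Real.sqrt (η * excess X c p q))) := by
        linarith
    _ = 2 * C * (Real.sqrt (excess X c a b / η) * Real.sqrt (η * excess X c p q)) := by ring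
    _ = _ := by rw [e]

/-- Here `A`, `D`, `B` are the lengths of three consecutive intervals and `p`, `q` the velocity
jumps between neighbours; the combined vector is the jump between the first two together and the
third. The hypothesis `B ≤ D` keeps the two corners from acting as one. -/
theorem norm_sq_smul_add_le {A D B K : ℝ} (hA : 0 < A) (hD : 0 < D) (hB : 0 < B) (hBD : B ≤ D)
    {p q : H} (hp : A * D / (A + D) * ‖p‖ ^ 2 ≤ K) (hq : D * B / (D + B) * ‖q‖ ^ 2 ≤ K) :
    (A + D) * B / (A + D + B) * ‖(A / (A + D)) • p + q‖ ^ 2 ≤ 6 * K := by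
  have K0 : 0 ≤ K := le_trans (by positivity) hp
  have h1 : ‖(A / (A + D)) • p + q‖ ^ 2 ≤ 2 * ((A / (A + D)) ^ 2 * ‖p‖ ^ 2) + 2 * ‖q‖ ^ 2 := by
    have t := norm_add_le ((A / (A + D)) • p) q
    rw [norm_smul, Real.norm_of_nonneg (by positivity)] at t
    have := pow_le_pow_left₀ (norm_nonneg _) t 2
    nlinarith [sq_nonneg (A / (A + D) * ‖p‖ - ‖q‖)]
  have h2 : (A + D) * B / (A + D + B) ≤ B := by
    rw [div_le_iff₀ (by positivity)]; nlinarith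
  have h3 : B * ((A / (A + D)) ^ 2 * ‖p‖ ^ 2) ≤ K := by
    refine le_trans ?_ hp
    rw [← mul_assoc]
    refine mul_le_mul_of_nonneg_right ?_ (by positivity)
    rw [div_pow, ← mul_div_assoc, div_le_div_iff₀ (by positivity) (by positivity)]
    have : 0 ≤ A * (A + D) * (D * (A + D) - B * A) := by
      have : 0 ≤ D * (A + D) - B * A := by nlinarith
      positivity
    nlinarith
  have h4 : B * ‖q‖ ^ 2 ≤ 2 * K := by
    have : B / 2 ≤ D * B / (D + B) := by
      rw [div_le_div_iff₀ (by positivity) (by positivity)]; nlinarith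
    have := mul_le_mul_of_nonneg_right this (sq_nonneg ‖q‖)
    linarith
  calc _ ≤ B * (2 * ((A / (A + D)) ^ 2 * ‖p‖ ^ 2) + 2 * ‖q‖ ^ 2) :=
        mul_le_mul h2 h1 (by positivity) hB.le
    _ ≤ 6 * K := by linarith

/-- If almost all the excess between `a` and `b` stems from a corner at `i`, and likewise from a
corner at `j`, then there is none. -/
theorem SpeedLE.excess_eq_zero_of_corners {X : ℝ → H} {c : ℝ} {I : Set ℝ} (h : SpeedLE X c I)
    {a i j b γ : ℝ} (ha : a ∈ I) (hi : i ∈ I) (hj : j ∈ I) (hb : b ∈ I)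
    (hai : a < i) (hij : i < j) (hjb : j < b) (hγ : 8 * γ < 1)
    (hD : b - j ≤ j - i ∨ i - a ≤ j - i)
    (h₁ : excess X c a i + excess X c i b ≤ γ * excess X c a b)
    (h₂ : excess X c a j + excess X c j b ≤ γ * excess X c a b) :
    excess X c a b = 0 := by
  have E0 := h.excess_nonneg ha hb (hai.trans (hij.trans hjb)).le
  refine le_antisymm ?_ E0
  have n₁ := h.excess_nonneg ha hi hai.le
  have n₂ := h.excess_nonneg hi hb (hij.trans hjb).le
  have n₃ := h.excess_nonneg ha hj (hai.trans hij).le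
  have n₄ := h.excess_nonneg hj hb hjb.le
  have A0 := sub_pos.2 hai
  have D0 := sub_pos.2 hij
  have B0 := sub_pos.2 hjb
  have p₁ := h.norm_meanVel_sub_sq_le ha hi hj hai hij
  have q₁ := h.norm_meanVel_sub_sq_le hi hj hb hij hjb
  have eAD : j - a = (i - a) + (j - i) := by ring
  have eDB : b - i = (j - i) + (b - j) := by ring
  set p := meanVel X a i - meanVel X i j with hp
  set q := meanVel X i j - meanVel X j b with hq
  rw [eAD] at p₁
  rw [eDB] at q₁
  have p₂ : (i - a) * (j - i) / (i - a + (j - i)) * ‖p‖ ^ 2 ≤ γ * excess X c a b := by linarith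
  have q₂ : (j - i) * (b - j) / (j - i + (b - j)) * ‖q‖ ^ 2 ≤ γ * excess X c a b := by linarith
  -- The corner at `j` makes the jump `p` at `i` small, and the corner at `i` makes the jump `q` at
  -- `j` small. Splitting at the end of the shorter outer interval bounds the excess by `(1 + 6) *
  -- γ` times itself, which `8 * γ < 1` excludes unless it is zero.
  rcases hD with hD | hD
  · have k := norm_sq_smul_add_le A0 D0 B0 hD p₂ q₂
    have s := excess_split X c (hai.trans hij) hjb
    have e : meanVel X a j - meanVel X j b = ((i - a) / (i - a + (j - i))) • p + q := by
      rw [meanVel_eq X hai hij, hp, hq, eAD, smul_sub]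
      have : meanVel X i j = ((i - a) / (i - a + (j - i))) • meanVel X i j
          + ((j - i) / (i - a + (j - i))) • meanVel X i j := by
        rw [← add_smul, ← add_div, div_self (by positivity), one_smul]
      nth_rewrite 3 [this]
      abel
    rw [e, show b - a = i - a + (j - i) + (b - j) by ring, eAD] at s
    nlinarith
  · have k := norm_sq_smul_add_le (p := q) (q := p) (K := γ * excess X c a b) B0 D0 A0 hD (by
      rwa [mul_comm (b - j), add_comm (b - j)]) (by rwa [mul_comm (j - i), add_comm (j - i)])
    have s := excess_split X c hai (hij.trans hjb)
    have e : meanVel X a i - meanVel X i b = ((b - j) / (b - j + (j - i))) • q + p := by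
      rw [meanVel_eq X hij hjb, hp, hq, eDB, smul_sub, add_comm (b - j)]
      have : meanVel X i j = ((j - i) / (j - i + (b - j))) • meanVel X i j
          + ((b - j) / (j - i + (b - j))) • meanVel X i j := by
        rw [← add_smul, ← add_div, div_self (by positivity), one_smul]
      nth_rewrite 3 [this]
      abel
    rw [e, show b - a = b - j + (j - i) + (i - a) by ring, eDB, mul_comm (i - a),
      add_comm (j - i) (b - j)] at s
    nlinarith

/-- Among `m` consecutive disjoint pairs of time steps, one carries at most the average excess. -/
theorem exists_excess_le (X : ℝ → H) (c : ℝ) {τ : ℕ → ℝ} (hτ : StrictMono τ) (k : ℕ) {m : ℕ}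
    (hm : 0 < m) :
    ∃ p < m, (m : ℝ) * excess X c (τ (k + 2 * p)) (τ (k + 2 * p + 2))
      ≤ excess X c (τ k) (τ (k + 2 * m)) := by
  have hsum : ∀ m' : ℕ, m' ≤ m →
      ∑ p ∈ Finset.range m', excess X c (τ (k + 2 * p)) (τ (k + 2 * p + 2))
        ≤ excess X c (τ k) (τ (k + 2 * m')) := by
    intro m' hm'
    induction m' with
    | zero => simp [excess_self]
    | succ l ih =>
      rw [Finset.sum_range_succ]
      have := excess_add_le X c (hτ.monotone (show k ≤ k + 2 * l by omega))
        (hτ.monotone (show k + 2 * l ≤ k + 2 * l + 2 by omega))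
      have := ih (by omega)
      rw [show k + 2 * (l + 1) = k + 2 * l + 2 by ring]
      linarith
  by_contra! hcon
  have h2 : ∑ p ∈ Finset.range m, excess X c (τ k) (τ (k + 2 * m))
      < ∑ p ∈ Finset.range m, (m : ℝ) * excess X c (τ (k + 2 * p)) (τ (k + 2 * p + 2)) :=
    Finset.sum_lt_sum_of_nonempty (by simpa using hm.ne') fun p hp => hcon p (Finset.mem_range.1 hp)
  rw [Finset.sum_const, Finset.card_range, nsmul_eq_mul, ← Finset.mul_sum] at h2
  have := lt_of_mul_lt_mul_left h2 (Nat.cast_nonneg m)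
  linarith [hsum m le_rfl]

/-- A path which visits all of the sets many times in a row has a straight stretch. -/
theorem exists_excess_eq_zero {ι : Type*} {B : ι → Set H} {C : ℝ} (hC : 0 ≤ C)
    (hnd : Nondegenerate B C) (hB : ∀ k, Convex ℝ (B k)) {X : ℝ → H} {c : ℝ} {I : Set ℝ}
    (hI : I.OrdConnected) (h : SpeedLE X c I)
    (hconv : ∀ z, (∀ k, z ∈ B k) → ConvexOn ℝ I fun τ => ‖X τ - z‖ ^ 2 - c * τ ^ 2)
    {m : ℕ} (hm : 256 * C ^ 2 < m) {τ : ℕ → ℝ} (hτ : StrictMono τ)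
    (hτI : ∀ l ≤ 8 * m, τ l ∈ I)
    (hits : ∀ l < 8 * m, ∀ k, ∃ s ∈ Set.Ioo (τ l) (τ (l + 1)), X s ∈ B k) :
    ∃ l l', l + 2 ≤ l' ∧ l' ≤ 8 * m ∧ excess X c (τ l) (τ l') = 0 := by
  have m0' : (0 : ℝ) < m := lt_of_le_of_lt (by positivity) hm
  have m0 : 0 < m := by exact_mod_cast m0'
  -- A window of `6 * m` steps has three thirds; corners are sought in the outer ones, and the
  -- middle one must be at least as long as one of them. Comparing the second and third quarters of
  -- the `8 * m` steps shows that the window starting at `0` or the one starting at `2 * m`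
  -- qualifies.
  suffices key : ∀ k, k + 6 * m ≤ 8 * m →
      (τ (k + 4 * m) - τ (k + 2 * m) ≥ τ (k + 2 * m) - τ k ∨
       τ (k + 4 * m) - τ (k + 2 * m) ≥ τ (k + 6 * m) - τ (k + 4 * m)) →
      excess X c (τ k) (τ (k + 6 * m)) = 0 by
    rcases le_total (τ (0 + 4 * m) - τ (0 + 2 * m)) (τ (0 + 6 * m) - τ (0 + 4 * m)) with hle | hle
    · refine ⟨2 * m, 2 * m + 6 * m, by omega, by omega, key _ (by omega) (Or.inl ?_)⟩
      rw [show 2 * m + 4 * m = 0 + 6 * m by ring, show 2 * m + 2 * m = 0 + 4 * m by ring]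
      rw [zero_add (2 * m)] at hle
      exact hle
    · exact ⟨0, 0 + 6 * m, by omega, by omega, key 0 (by omega) (Or.inr hle)⟩
  intro k hk hmid
  -- This is `16 * C < √m`, the origin of the constant `256 = 16²`.
  have γ8 : 8 * (2 * C * Real.sqrt (1 / m)) < 1 := by
    have : Real.sqrt (1 / m) * (16 * C) < 1 := by
      rw [← abs_of_nonneg (show 0 ≤ Real.sqrt (1 / m) * (16 * C) by positivity)]
      rw [← sq_lt_one_iff_abs_lt_one, mul_pow, Real.sq_sqrt (by positivity), one_div,
        inv_mul_lt_iff₀ m0']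
      linarith
    linarith
  have corner : ∀ l, k ≤ l → l + 2 ≤ k + 6 * m →
      (m : ℝ) * excess X c (τ l) (τ (l + 2)) ≤ excess X c (τ k) (τ (k + 6 * m)) →
      excess X c (τ k) (τ (l + 1)) + excess X c (τ (l + 1)) (τ (k + 6 * m))
        ≤ 2 * C * Real.sqrt (1 / m) * excess X c (τ k) (τ (k + 6 * m)) := by
    intro l hkl hl hle
    have E0 := h.excess_nonneg (hτI k (by omega)) (hτI (k + 6 * m) hk) (hτ.monotone (by omega))
    refine (excess_add_le_sqrt hnd hB hI h hconv (hτI k (by omega)) (hτI (k + 6 * m) hk)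
      (hτ.monotone hkl) (hτ (Nat.lt_succ_self l)) (hτ (Nat.lt_succ_self (l + 1)))
      (hτ.monotone hl) (hits l (by omega)) (hits (l + 1) (by omega))).trans ?_
    rw [mul_assoc (2 * C)]
    refine mul_le_mul_of_nonneg_left (Real.sqrt_le_iff.2 ⟨by positivity, ?_⟩) (by positivity)
    rw [mul_pow, Real.sq_sqrt (by positivity), sq (excess X c _ _), ← mul_assoc]
    refine mul_le_mul_of_nonneg_right ?_ E0
    rw [one_div, le_inv_mul_iff₀ m0']
    exact hle
  obtain ⟨p, hp, hpE⟩ := exists_excess_le X c hτ k m0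
  obtain ⟨q, hq, hqE⟩ := exists_excess_le X c hτ (k + 4 * m) m0
  have mono₁ := h.excess_mono (hτI k (by omega)) (hτI k (by omega)) (hτI (k + 2 * m) (by omega))
    (hτI (k + 6 * m) hk) le_rfl (hτ.monotone (by omega)) (hτ.monotone (by omega))
  have mono₂ := h.excess_mono (hτI k (by omega)) (hτI (k + 4 * m) (by omega))
    (hτI (k + 4 * m + 2 * m) (by omega)) (hτI (k + 6 * m) hk) (hτ.monotone (by omega))
    (hτ.monotone (by omega)) (hτ.monotone (by omega))
  have c₁ := corner (k + 2 * p) (by omega) (by omega) (hpE.trans mono₁)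
  have c₂ := corner (k + 4 * m + 2 * q) (by omega) (by omega) (hqE.trans mono₂)
  refine h.excess_eq_zero_of_corners (hτI k (by omega)) (hτI _ (by omega)) (hτI _ (by omega))
    (hτI _ hk) (hτ (by omega)) (hτ (by omega)) (hτ (by omega)) γ8 ?_ c₁ c₂
  have t₁ := hτ.monotone (show k + 2 * p + 1 ≤ k + 2 * m by omega)
  have t₂ := hτ.monotone (show k + 4 * m ≤ k + 4 * m + 2 * q + 1 by omega)
  rcases hmid with hmid | hmid
  · right; linarith
  · left; linarith

/-- Zero excess means straight uniform motion. -/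
theorem SpeedLE.eq_of_excess_eq_zero {X : ℝ → H} {c : ℝ} {I : Set ℝ} (h : SpeedLE X c I)
    {a b : ℝ} (ha : a ∈ I) (hb : b ∈ I) (hE : excess X c a b = 0) {t : ℝ} (ht : t ∈ I)
    (hat : a < t) (htb : t < b) : X t = X a + (t - a) • meanVel X a b := by
  have A0 := sub_pos.2 hat
  have B0 := sub_pos.2 htb
  have D0 := sub_pos.2 (hat.trans htb)
  have k := h.norm_meanVel_sub_sq_le ha ht hb hat htb
  have z : ‖meanVel X a t - meanVel X t b‖ ^ 2 ≤ 0 := by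
    rw [hE] at k
    exact nonpos_of_mul_nonpos_right k
      (show 0 < (t - a) * (b - t) / (b - a) by positivity)
  have z₂ : ‖meanVel X a t - meanVel X t b‖ ^ 2 = 0 := le_antisymm z (by positivity)
  have z' : meanVel X a t = meanVel X t b := by
    rw [← sub_eq_zero, ← norm_eq_zero]
    exact (pow_eq_zero_iff two_ne_zero).1 z₂
  have e : meanVel X a b = meanVel X a t := by
    rw [meanVel_eq X hat htb, ← z', ← add_smul, ← add_div,
      show t - a + (b - t) = b - a by ring, div_self D0.ne', one_smul]
  rw [e, smul_meanVel X hat]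
  abel

end Excess

/-! ### Convexity from local kinks -/

/-- A function on an interval which near every point is affine on both sides, with slope not
smaller on the right, is convex. -/
theorem convexOn_of_local_kinks {I : Set ℝ} (hI : I.OrdConnected) {g : ℝ → ℝ}
    (hg : ∀ t ∈ I, ∃ α β : ℝ, α ≤ β ∧ (∀ᶠ s in 𝓝[<] t, g s = g t + (s - t) * α) ∧
      ∀ᶠ s in 𝓝[>] t, g s = g t + (s - t) * β) : ConvexOn ℝ I g := by
  have hcont : ∀ t ∈ I, ContinuousAt g t := by
    intro t ht
    obtain ⟨α, β, -, hα, hβ⟩ := hg t ht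
    rw [continuousAt_iff_continuous_left'_right']
    have lim : ∀ γ : ℝ, ∀ S : Set ℝ, Tendsto (fun s => g t + (s - t) * γ) (𝓝[S] t) (𝓝 (g t)) := by
      intro γ S
      have : ContinuousAt (fun s => g t + (s - t) * γ) t := by fun_prop
      simpa [ContinuousAt] using this.tendsto.mono_left (nhdsWithin_le_nhds (s := S))
    exact ⟨(lim α _).congr' (hα.mono fun s hs => hs.symm),
      (lim β _).congr' (hβ.mono fun s hs => hs.symm)⟩
  refine LinearOrder.convexOn_of_lt hI.convex fun x hx y hy hxy a b ha hb hab => ?_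
  set κ := (g y - g x) / (y - x) with hκ
  set f : ℝ → ℝ := fun s => g s - g x - (s - x) * κ with hf
  have fx : f x = 0 := by simp [hf]
  have fy : f y = 0 := by
    have := (sub_pos.2 hxy).ne'
    simp only [hf, hκ]
    field_simp
    ring
  have sub : Set.Icc x y ⊆ I := hI.out hx hy
  have fc : ContinuousOn f (Set.Icc x y) := by
    intro s hs
    have := hcont s (sub hs)
    exact ContinuousAt.continuousWithinAt (by fun_prop)
  obtain ⟨p₀, hp₀, hmax⟩ := isCompact_Icc.exists_isMaxOn (Set.nonempty_Icc.2 hxy.le) fc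
  have hmax' : ∀ s ∈ Set.Icc x y, f s ≤ f p₀ := fun s hs => hmax hs
  have f0 : f p₀ ≤ 0 := by
    by_contra! hpos
    have hcl : IsCompact (Set.Icc x y ∩ f ⁻¹' {f p₀}) :=
      isCompact_Icc.of_isClosed_subset (fc.preimage_isClosed_of_isClosed isClosed_Icc
        isClosed_singleton) Set.inter_subset_left
    -- At the last maximum of `f`, the left slope is nonnegative, hence so is the right slope, and
    -- the maximal value is attained again further right.
    obtain ⟨p, ⟨hp, hfp⟩, hgr⟩ := hcl.exists_isGreatest ⟨p₀, hp₀, rfl⟩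
    have hfp : f p = f p₀ := hfp
    have hxp : x < p := lt_of_le_of_ne hp.1 (by rintro rfl; linarith)
    have hpy : p < y := lt_of_le_of_ne hp.2 (by rintro rfl; linarith)
    obtain ⟨α, β, hαβ, hα, hβ⟩ := hg p (sub hp)
    obtain ⟨s, ⟨hs, hsx⟩, hsp⟩ := ((hα.and (eventually_nhdsWithin_of_eventually_nhds
      (eventually_gt_nhds hxp))).and self_mem_nhdsWithin).exists
    obtain ⟨r, ⟨hr, hry⟩, hrp⟩ := ((hβ.and (eventually_nhdsWithin_of_eventually_nhds
      (eventually_lt_nhds hpy))).and self_mem_nhdsWithin).exists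
    have hsp : s < p := hsp
    have hrp : p < r := hrp
    have hs' := hmax' s ⟨hsx.le, by linarith⟩
    have hr' := hmax' r ⟨by linarith, hry.le⟩
    have es : f s = f p + (s - p) * (α - κ) := by simp only [hf]; rw [hs]; ring
    have er : f r = f p + (r - p) * (β - κ) := by simp only [hf]; rw [hr]; ring
    have : 0 ≤ α - κ := by nlinarith
    have hr2 : f r = f p₀ := le_antisymm hr' (by rw [er, hfp]; nlinarith)
    have := hgr ⟨⟨by linarith, hry.le⟩, hr2⟩
    linarith
  have hmem : a * x + b * y ∈ Set.Icc x y :=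
    convex_Icc x y (Set.left_mem_Icc.2 hxy.le) (Set.right_mem_Icc.2 hxy.le) ha.le hb.le hab
  have h1 := (hmax' _ hmem).trans f0
  have e : b * (y - x) * κ = b * (g y - g x) := by
    have := (sub_pos.2 hxy).ne'
    rw [hκ]; field_simp
  have e2 : a * x + b * y - x = b * (y - x) := by
    have : a = 1 - b := by linarith
    rw [this]; ring
  simp only [hf] at h1
  rw [e2, e] at h1
  simp only [smul_eq_mul]
  have : a = 1 - b := by linarith
  rw [this] at h1 ⊢
  linarith

/-! ### Velocities -/

theorem VelBefore.unique {n : ℕ} {a : ℝ → Fin n → Space} {t : ℝ} {u u' : Fin n → Space}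
    (h : VelBefore a t u) (h' : VelBefore a t u') : u = u' := by
  obtain ⟨s, ⟨hs, hs'⟩, hst⟩ := ((h.and h').and self_mem_nhdsWithin).exists
  have hst : s < t := hst
  funext i
  have := (hs i).symm.trans (hs' i)
  exact smul_right_injective _ (sub_ne_zero.2 hst.ne) (add_left_cancel this)

theorem velBefore_of_affine {n : ℕ} {a : ℝ → Fin n → Space} {p q t₀ s : ℝ} {u x : Fin n → Space}
    (h : ∀ r ∈ Set.Ioo p q, ∀ i, a r i = x i + (r - t₀) • u i) (hs : s ∈ Set.Ioo p q) :
    VelBefore a s u := by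
  filter_upwards [Ioo_mem_nhdsLT hs.1] with r hr i
  rw [h r ⟨hr.1, hr.2.trans hs.2⟩ i, h s hs i, add_assoc, ← add_smul]
  congr 2
  ring

theorem VelBefore.eventually {n : ℕ} {a : ℝ → Fin n → Space} {t : ℝ} {u : Fin n → Space}
    (h : VelBefore a t u) : ∀ᶠ s in 𝓝[<] t, VelBefore a s u := by
  obtain ⟨l, hl, hs⟩ := mem_nhdsLT_iff_exists_Ioo_subset.1 h
  filter_upwards [Ioo_mem_nhdsLT hl] with s hs'
  exact velBefore_of_affine (fun r hr => hs hr) hs'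

theorem VelAfter.eventually {n : ℕ} {a : ℝ → Fin n → Space} {t : ℝ} {w : Fin n → Space}
    (h : VelAfter a t w) : ∀ᶠ s in 𝓝[>] t, VelBefore a s w := by
  obtain ⟨l, hl, hs⟩ := mem_nhdsGT_iff_exists_Ioo_subset.1 h
  filter_upwards [Ioo_mem_nhdsGT hl] with s hsl
  exact velBefore_of_affine (fun r hr => hs hr) hsl

/-- A straight motion which starts at minimal distance from the origin does not approach it. -/
theorem inner_nonneg_of_norm_le {E : Type*} [NormedAddCommGroup E] [InnerProductSpace ℝ E]
    {ρ ω : E} (h : ∀ᶠ s in 𝓝[>] (0 : ℝ), ‖ρ‖ ≤ ‖ρ + s • ω‖) : 0 ≤ inner ℝ ρ ω := by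
  have h2 : ∀ᶠ s in 𝓝[>] (0 : ℝ), 0 ≤ 2 * inner ℝ ρ ω + s * ‖ω‖ ^ 2 := by
    filter_upwards [h, self_mem_nhdsWithin] with s hs hpos
    have hpos : 0 < s := hpos
    have := pow_le_pow_left₀ (norm_nonneg _) hs 2
    rw [norm_add_sq_real, norm_smul, mul_pow, Real.norm_eq_abs, sq_abs, inner_smul_right] at this
    refine nonneg_of_mul_nonneg_left (b := s) ?_ hpos
    linarith
  have lim : Tendsto (fun s : ℝ => 2 * inner ℝ ρ ω + s * ‖ω‖ ^ 2) (𝓝[>] 0)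
      (𝓝 (2 * inner ℝ ρ ω)) := by
    have : ContinuousAt (fun s : ℝ => 2 * inner ℝ ρ ω + s * ‖ω‖ ^ 2) 0 := by fun_prop
    simpa [ContinuousAt] using this.tendsto.mono_left (nhdsWithin_le_nhds (s := Set.Ioi 0))
  have := ge_of_tendsto lim h2
  linarith

theorem VelAfter.inner_nonneg {n : ℕ} {a : ℝ → Fin n → Space} {t : ℝ} {w : Fin n → Space}
    (h : VelAfter a t w) {i j : Fin n}
    (hd : ∀ᶠ s in 𝓝 t, dist (a t i) (a t j) ≤ dist (a s i) (a s j)) :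
    0 ≤ inner ℝ (a t i - a t j) (w i - w j) := by
  refine inner_nonneg_of_norm_le ?_
  have lim : Tendsto (fun s : ℝ => t + s) (𝓝[>] 0) (𝓝[>] t) := by
    refine tendsto_nhdsWithin_iff.2 ⟨?_, ?_⟩
    · have : ContinuousAt (fun s : ℝ => t + s) 0 := by fun_prop
      simpa [ContinuousAt] using this.tendsto.mono_left (nhdsWithin_le_nhds (s := Set.Ioi 0))
    · filter_upwards [self_mem_nhdsWithin] with s hs
      simpa using hs
  filter_upwards [lim.eventually h, lim.eventually (hd.filter_mono nhdsWithin_le_nhds)] with s h₁ h₂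
  rw [dist_eq_norm, dist_eq_norm, h₁, h₁] at h₂
  refine h₂.trans_eq (congrArg _ ?_)
  rw [add_sub_cancel_left, smul_sub]
  abel

theorem VelBefore.inner_nonpos {n : ℕ} {a : ℝ → Fin n → Space} {t : ℝ} {u : Fin n → Space}
    (h : VelBefore a t u) {i j : Fin n}
    (hd : ∀ᶠ s in 𝓝 t, dist (a t i) (a t j) ≤ dist (a s i) (a s j)) :
    inner ℝ (a t i - a t j) (u i - u j) ≤ 0 := by
  rw [← neg_nonneg, ← inner_neg_right]
  refine inner_nonneg_of_norm_le ?_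
  have lim : Tendsto (fun s : ℝ => t - s) (𝓝[>] 0) (𝓝[<] t) := by
    refine tendsto_nhdsWithin_iff.2 ⟨?_, ?_⟩
    · have : ContinuousAt (fun s : ℝ => t - s) 0 := by fun_prop
      simpa [ContinuousAt] using this.tendsto.mono_left (nhdsWithin_le_nhds (s := Set.Ioi 0))
    · filter_upwards [self_mem_nhdsWithin] with s hs
      simpa using hs
  filter_upwards [lim.eventually h, lim.eventually (hd.filter_mono nhdsWithin_le_nhds)] with s h₁ h₂
  rw [dist_eq_norm, dist_eq_norm, h₁, h₁] at h₂
  refine h₂.trans_eq (congrArg _ ?_)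
  rw [show t - s - t = -s by ring, smul_neg, smul_sub, neg_smul, neg_smul]
  abel

/-! ### Elastic collisions -/

theorem ElasticLaw.exists_impulse {n : ℕ} {M : Fin n → ℝ} {x : Fin n → Space} {i j : Fin n}
    {u w : Fin n → Space} (h : ElasticLaw M x i j u w) :
    ∃ c : ℝ, w i = u i + c • (x i - x j) ∧ M j • w j = M j • u j - (M i * c) • (x i - x j) := by
  obtain ⟨c, hc⟩ := h.normal
  have h1 : w i = u i + c • (x i - x j) := by rw [← hc]; abel
  refine ⟨c, h1, ?_⟩
  have := h.momentum
  rw [h1, smul_add, smul_smul] at this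
  rw [eq_sub_iff_add_eq]
  refine add_left_cancel (a := M i • u i) ?_
  rw [← this]
  abel

/-- In the common rest frame the two balls have no kinetic energy, so there can be no impulse. Hence
every actual change of velocities is counted as a collision. -/
theorem ElasticLaw.eq_of_eq {n : ℕ} {M : Fin n → ℝ} {x : Fin n → Space} {i j : Fin n}
    {u w : Fin n → Space} (h : ElasticLaw M x i j u w) (hi : 0 < M i) (hj : 0 < M j)
    (hu : u i = u j) : w = u := by
  obtain ⟨c, h1, h2⟩ := h.exists_impulse
  have h3 : w j = u j - (M i / M j * c) • (x i - x j) := by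
    have := congrArg (fun v => (M j)⁻¹ • v) h2
    simp only [smul_sub, smul_smul, inv_mul_cancel₀ hj.ne', one_smul] at this
    rw [this, ← smul_sub, show (M j)⁻¹ * (M i * c) = M i / M j * c by field_simp]
  have he := h.energy
  rw [h1, h3, hu, norm_add_sq_real, norm_sub_sq_real, norm_smul, norm_smul, mul_pow, mul_pow,
    Real.norm_eq_abs, Real.norm_eq_abs, sq_abs, sq_abs, inner_smul_right, inner_smul_right] at he
  have hz : (M i / 2 + M i ^ 2 / (2 * M j)) * (c ^ 2 * ‖x i - x j‖ ^ 2) = 0 := by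
    have e : M j / 2 * (M i / M j * c) ^ 2 = M i ^ 2 / (2 * M j) * c ^ 2 := by field_simp
    have e' : M j / 2 * (2 * (M i / M j * c)) = M i * c := by field_simp
    linear_combination he + (-‖x i - x j‖ ^ 2) * e + inner ℝ (u j) (x i - x j) * e'
  have hz' : ‖c • (x i - x j)‖ ^ 2 = 0 := by
    rw [norm_smul, mul_pow, Real.norm_eq_abs, sq_abs]
    exact (mul_eq_zero.1 hz).resolve_left (by positivity)
  have hz'' : c • (x i - x j) = 0 := by simpa using hz'
  funext k
  by_cases hki : k = i
  · rw [hki, h1, hz'', add_zero]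
  by_cases hkj : k = j
  · rw [hkj, h3, mul_smul, hz'', smul_zero, sub_zero]
  exact h.others k hki hkj

theorem ElasticLaw.sum_energy {n : ℕ} {M : Fin n → ℝ} {x : Fin n → Space} {i j : Fin n}
    {u w : Fin n → Space} (h : ElasticLaw M x i j u w) (hij : i ≠ j) :
    ∑ k, M k * ‖w k‖ ^ 2 = ∑ k, M k * ‖u k‖ ^ 2 := by
  rw [← sub_eq_zero, ← Finset.sum_sub_distrib, Fintype.sum_eq_add i j hij]
  · linarith [h.energy]
  · rintro k ⟨h1, h2⟩
    rw [h.others k h1 h2, sub_self]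

/-- At a collision, the motion in configuration space turns away from every configuration in which
the colliding balls do not lie further apart than in contact. -/
theorem ElasticLaw.sum_inner_le {n : ℕ} {M : Fin n → ℝ} {x : Fin n → Space} {i j : Fin n}
    {u w : Fin n → Space} (h : ElasticLaw M x i j u w) (hij : i ≠ j) (hi : 0 < M i) (hj : 0 < M j)
    (hx : x i ≠ x j) (hu : inner ℝ (x i - x j) (u i - u j) ≤ 0)
    (hw : 0 ≤ inner ℝ (x i - x j) (w i - w j)) {z : Fin n → Space}
    (hz : dist (z i) (z j) ≤ dist (x i) (x j)) :
    ∑ k, M k * inner ℝ (x k - z k) (u k) ≤ ∑ k, M k * inner ℝ (x k - z k) (w k) := by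
  obtain ⟨c, h1, h2⟩ := h.exists_impulse
  have hρ : 0 < ‖x i - x j‖ ^ 2 := by
    have := norm_pos_iff.2 (sub_ne_zero.2 hx)
    positivity
  have h2' : ∀ v, M j * inner ℝ v (w j)
      = M j * inner ℝ v (u j) - M i * c * inner ℝ v (x i - x j) := by
    intro v
    rw [← inner_smul_right, h2, inner_sub_right, inner_smul_right, inner_smul_right]
  -- The impulse is repulsive, since it turns approach into separation: `c * (M i + M j) * ‖x i - x
  -- j‖ ^ 2` is `M j` times the gain in the normal relative velocity.
  have hc : 0 ≤ c := by
    have a := h2' (x i - x j)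
    rw [real_inner_self_eq_norm_sq] at a
    rw [inner_sub_right] at hu hw
    rw [h1, inner_add_right, inner_smul_right, real_inner_self_eq_norm_sq] at hw
    have b := mul_nonneg hj.le hw
    have b' := mul_nonneg hj.le (neg_nonneg.2 hu)
    have : 0 ≤ c * ((M i + M j) * ‖x i - x j‖ ^ 2) := by nlinarith
    exact nonneg_of_mul_nonneg_left this (by positivity)
  rw [← sub_nonneg, ← Finset.sum_sub_distrib, Fintype.sum_eq_add i j hij]
  · rw [h2', h1, inner_add_right, inner_smul_right]
    have e : inner ℝ (x i - z i) (x i - x j) - inner ℝ (x j - z j) (x i - x j)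
        = ‖x i - x j‖ ^ 2 - inner ℝ (z i - z j) (x i - x j) := by
      rw [← real_inner_self_eq_norm_sq, ← inner_sub_left, ← inner_sub_left]
      congr 1
      abel
    have f : inner ℝ (z i - z j) (x i - x j) ≤ ‖x i - x j‖ ^ 2 := by
      refine (real_inner_le_norm _ _).trans ?_
      rw [dist_eq_norm, dist_eq_norm] at hz
      rw [sq]
      exact mul_le_mul_of_nonneg_right hz (norm_nonneg _)
    have : 0 ≤ M i * c * (inner ℝ (x i - z i) (x i - x j) - inner ℝ (x j - z j) (x i - x j)) := by
      rw [e]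
      have := sub_nonneg.2 f
      positivity
    linarith
  · rintro k ⟨h1, h2⟩
    rw [h.others k h1 h2, sub_self]

/-! ### Motions -/

/-- The pairs of balls that collide during `I`. -/
def collidingPairs {n : ℕ} (R : Fin n → ℝ) (I : Set ℝ) (a : ℝ → Fin n → Space) :
    Set (Fin n × Fin n) := {p | ∃ t, (t, p) ∈ collisions R I a}

theorem IsMotion.exists_local_law {n : ℕ} {R M : Fin n → ℝ} (hR : ∀ i, 0 < R i)
    (hM : ∀ i, 0 < M i) {I : Set ℝ} {a : ℝ → Fin n → Space} (h : IsMotion R M I a)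
    {t : ℝ} (ht : t ∈ I) :
    ∃ u w, VelBefore a t u ∧ VelAfter a t w ∧
      ∑ k, M k * ‖w k‖ ^ 2 = ∑ k, M k * ‖u k‖ ^ 2 ∧
      ∀ z : Fin n → Space,
        (∀ p ∈ collidingPairs R I a, dist (z p.1) (z p.2) ≤ R p.1 + R p.2) →
        ∑ k, M k * inner ℝ (a t k - z k) (u k) ≤ ∑ k, M k * inner ℝ (a t k - z k) (w k) := by
  obtain ⟨u, w, hu, hw, rfl | ⟨i, j, htouch, hel⟩⟩ := h.law t ht
  · exact ⟨w, w, hu, hw, rfl, fun _ _ => le_rfl⟩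
  refine ⟨u, w, hu, hw, hel.sum_energy htouch.1, fun z hz => ?_⟩
  by_cases huu : u i = u j
  · rw [hel.eq_of_eq (hM i) (hM j) huu]
  have hd : ∀ᶠ s in 𝓝 t, dist (a t i) (a t j) ≤ dist (a s i) (a s j) := by
    filter_upwards [h.isOpen.mem_nhds ht] with s hs
    rw [htouch.2]
    exact h.hard s hs i j htouch.1
  have hx : a t i ≠ a t j := by
    rw [← dist_pos, htouch.2]
    exact add_pos (hR i) (hR j)
  refine hel.sum_inner_le htouch.1 (hM i) (hM j) hx (hu.inner_nonpos hd) (hw.inner_nonneg hd) ?_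
  rw [htouch.2]
  -- Collisions are recorded with the smaller index first, whereas the elastic law allows either
  -- order.
  rcases lt_or_gt_of_ne htouch.1 with hij | hij
  · exact hz (i, j) ⟨t, ht, hij, htouch, u, hu, huu⟩
  · rw [dist_comm, add_comm]
    exact hz (j, i) ⟨t, ht, hij, ⟨htouch.1.symm, by rw [dist_comm, add_comm]; exact htouch.2⟩, u, hu,
      fun e => huu e.symm⟩

/-- The energy of the velocity just before `t` is a locally constant function of `t`, hence constant
on the connected set `I`. No finiteness of the collisions is needed. -/
theorem IsMotion.exists_energy {n : ℕ} {R M : Fin n → ℝ} (hR : ∀ i, 0 < R i)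
    (hM : ∀ i, 0 < M i) {I : Set ℝ} {a : ℝ → Fin n → Space} (h : IsMotion R M I a) :
    ∃ c, ∀ t ∈ I, ∀ u, VelBefore a t u → ∑ k, M k * ‖u k‖ ^ 2 = c := by
  choose! u w hu hw he _ using fun t ht => h.exists_local_law hR hM (t := t) ht
  set e : ℝ → ℝ := fun t => ∑ k, M k * ‖u t k‖ ^ 2 with he'
  have hloc : ∀ t ∈ I, ∀ᶠ s in 𝓝 t, e s = e t := by
    intro t ht
    have hI : ∀ᶠ s in 𝓝 t, s ∈ I := h.isOpen.mem_nhds ht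
    rw [← nhdsNE_sup_pure, ← nhdsLT_sup_nhdsGT, eventually_sup, eventually_sup]
    refine ⟨⟨?_, ?_⟩, eventually_pure.2 rfl⟩
    · filter_upwards [(hu t ht).eventually, hI.filter_mono nhdsWithin_le_nhds] with s hs hsI
      simp only [he', (hu s hsI).unique hs]
    · filter_upwards [(hw t ht).eventually, hI.filter_mono nhdsWithin_le_nhds] with s hs hsI
      simp only [he', (hu s hsI).unique hs]
      exact he t ht
  have hderiv : ∀ t ∈ I, HasDerivAt e 0 t := fun t ht =>
    (hasDerivAt_const t (e t)).congr_of_eventuallyEq (hloc t ht)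
  obtain ⟨c, hc⟩ := h.isOpen.exists_is_const_of_deriv_eq_zero h.ordConnected.isPreconnected
    (fun t ht => (hderiv t ht).differentiableAt.differentiableWithinAt)
    (fun t ht => (hderiv t ht).deriv)
  refine ⟨c, fun t ht v hv => ?_⟩
  rw [← hc t ht, hv.unique (hu t ht)]

/-! ### The mass metric, and the walls with their nondegeneracy -/

/-- Configuration space with the mass metric, in which the squared norm is `∑ k, M k * ‖x k‖ ^ 2`,
in orthonormal coordinates. -/
noncomputable def massEmb {n : ℕ} (M : Fin n → ℝ) :
    (Fin n → Space) →ₗ[ℝ] PiLp 2 fun _ : Fin n => Space where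
  toFun x := WithLp.toLp 2 fun k => √(M k) • x k
  map_add' x y := by ext1 k; simp [smul_add]
  map_smul' r x := by ext1 k; exact smul_comm (√(M k)) r (x k)

theorem massEmb_apply {n : ℕ} (M : Fin n → ℝ) (x : Fin n → Space) (k : Fin n) :
    massEmb M x k = √(M k) • x k := rfl

theorem inner_massEmb {n : ℕ} {M : Fin n → ℝ} (hM : ∀ i, 0 < M i) (x y : Fin n → Space) :
    inner ℝ (massEmb M x) (massEmb M y) = ∑ k, M k * inner ℝ (x k) (y k) := by
  rw [PiLp.inner_apply]
  refine Finset.sum_congr rfl fun k _ => ?_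
  rw [massEmb_apply, massEmb_apply, inner_smul_left, inner_smul_right, conj_trivial, ← mul_assoc,
    Real.mul_self_sqrt (hM k).le]

theorem norm_massEmb_sq {n : ℕ} {M : Fin n → ℝ} (hM : ∀ i, 0 < M i) (x : Fin n → Space) :
    ‖massEmb M x‖ ^ 2 = ∑ k, M k * ‖x k‖ ^ 2 := by
  rw [← real_inner_self_eq_norm_sq, inner_massEmb hM]
  simp only [real_inner_self_eq_norm_sq]

theorem massEmb_injective {n : ℕ} {M : Fin n → ℝ} (hM : ∀ i, 0 < M i) :
    Function.Injective (massEmb M) := by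
  intro x y h
  funext k
  have := congrArg (fun v => v k) h
  simp only [massEmb_apply] at this
  exact smul_right_injective _ (Real.sqrt_pos.2 (hM k)).ne' this

theorem massEmb_surjective {n : ℕ} {M : Fin n → ℝ} (hM : ∀ i, 0 < M i) :
    Function.Surjective (massEmb M) := by
  intro y
  refine ⟨fun k => (√(M k))⁻¹ • y k, ?_⟩
  ext1 k
  rw [massEmb_apply, smul_smul, mul_inv_cancel₀ (Real.sqrt_pos.2 (hM k)).ne', one_smul]

/-- The configurations, in the mass metric, in which two balls overlap or touch. -/
def wall {n : ℕ} (R M : Fin n → ℝ) (p : Fin n × Fin n) : Set (PiLp 2 fun _ : Fin n => Space) :=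
  massEmb M '' {z | dist (z p.1) (z p.2) ≤ R p.1 + R p.2}

theorem convex_wall {n : ℕ} (R M : Fin n → ℝ) (p : Fin n × Fin n) : Convex ℝ (wall R M p) := by
  refine Convex.linear_image ?_ _
  have : {z : Fin n → Space | dist (z p.1) (z p.2) ≤ R p.1 + R p.2}
      = (LinearMap.proj (R := ℝ) (φ := fun _ : Fin n => Space) p.1
          - LinearMap.proj (R := ℝ) (φ := fun _ : Fin n => Space) p.2) ⁻¹'
        Metric.closedBall 0 (R p.1 + R p.2) := by
    ext z
    simp [dist_eq_norm]
  rw [this]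
  exact (convex_closedBall _ _).linear_preimage _

theorem dist_le_walk_length {n : ℕ} {x : Fin n → Space} {G : SimpleGraph (Fin n)} {D : ℝ}
    (hG : ∀ i j, G.Adj i j → dist (x i) (x j) ≤ D) {i j : Fin n} (p : G.Walk i j) :
    dist (x i) (x j) ≤ p.length * D := by
  induction p with
  | nil => simp
  | cons hadj p ih =>
    rw [SimpleGraph.Walk.length_cons]
    push_cast
    linarith [dist_triangle _ _ _ |>.trans (add_le_add (hG _ _ hadj) ih)]

/-- If each pair of balls from `S` overlaps, touches or almost touches, then they all can be made
overlap or touch by small displacements. -/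
theorem exists_shrink {n : ℕ} {R : Fin n → ℝ} {ρ κ : ℝ} (hρ : 0 < ρ) (hRl : ∀ i, ρ ≤ R i)
    (hRu : ∀ i, R i ≤ κ * ρ) {S : Set (Fin n × Fin n)}
    {x : Fin n → Space} {d : ℝ} (hd : 0 ≤ d)
    (hx : ∀ p ∈ S, dist (x p.1) (x p.2) ≤ R p.1 + R p.2 + d) :
    ∃ z : Fin n → Space, (∀ p ∈ S, dist (z p.1) (z p.2) ≤ R p.1 + R p.2) ∧
      ∀ k, ‖z k - x k‖ ≤ n * κ * d := by
  classical
  set G : SimpleGraph (Fin n) := SimpleGraph.fromRel fun i j => (i, j) ∈ S with hG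
  -- The contraction factor that shrinks `2 * ρ + d` to `2 * ρ`; since `R i + R j ≥ 2 * ρ`, it also
  -- shrinks `R i + R j + d` to at most `R i + R j`.
  set l : ℝ := 2 * ρ / (2 * ρ + d) with hl
  have l0 : 0 ≤ l := by positivity
  have l1 : 1 - l = d / (2 * ρ + d) := by rw [hl]; field_simp; ring
  have l1' : 0 ≤ 1 - l := by rw [l1]; positivity
  have hadj : ∀ i j, G.Adj i j → dist (x i) (x j) ≤ 2 * (κ * ρ) + d := by
    intro i j hij
    rw [hG, SimpleGraph.fromRel_adj] at hij
    rcases hij.2 with h | h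
    · have := hx _ h
      simp only at this
      linarith [hRu i, hRu j]
    · have := hx _ h
      rw [dist_comm] at this
      simp only at this
      linarith [hRu i, hRu j]
  -- Each connected cluster is contracted towards the centre of one of its own balls. Its diameter
  -- is bounded by path lengths, so the displacements do not depend on how far apart different
  -- clusters are.
  set o : Fin n → Fin n := fun k => (G.connectedComponentMk k).out with ho
  have hreach : ∀ k, G.Reachable k (o k) := fun k =>
    SimpleGraph.ConnectedComponent.exact (Quot.out_eq (G.connectedComponentMk k)).symm
  refine ⟨fun k => x (o k) + l • (x k - x (o k)), fun p hp => ?_, fun k => ?_⟩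
  · have hoo : o p.1 = o p.2 := by
      by_cases h : p.1 = p.2
      · rw [h]
      · have : G.Adj p.1 p.2 := by
          rw [hG, SimpleGraph.fromRel_adj]
          exact ⟨h, Or.inl hp⟩
        simp only [ho]
        rw [SimpleGraph.ConnectedComponent.sound this.reachable]
    have e : x (o p.1) + l • (x p.1 - x (o p.1)) - (x (o p.2) + l • (x p.2 - x (o p.2)))
        = l • (x p.1 - x p.2) := by
      rw [hoo, smul_sub, smul_sub, smul_sub]
      abel
    rw [dist_eq_norm, e, norm_smul, Real.norm_of_nonneg l0, ← dist_eq_norm]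
    refine (mul_le_mul_of_nonneg_left (hx p hp) l0).trans ?_
    rw [hl, div_mul_eq_mul_div, div_le_iff₀ (by positivity)]
    nlinarith [mul_nonneg hd (sub_nonneg.2 (add_le_add (hRl p.1) (hRl p.2)))]
  · have e : x (o k) + l • (x k - x (o k)) - x k = (1 - l) • (x (o k) - x k) := by
      rw [sub_smul, one_smul, smul_sub, smul_sub]
      abel
    have hκ : 1 ≤ κ := by
      have := (hRl k).trans (hRu k)
      by_contra! hlt
      nlinarith
    obtain ⟨p, hp⟩ := (hreach k).exists_isPath
    have h1 := dist_le_walk_length hadj p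
    have h2 : (p.length : ℝ) ≤ n := by
      have := hp.length_lt
      rw [Fintype.card_fin] at this
      exact_mod_cast this.le
    have D0 : 0 ≤ 2 * (κ * ρ) + d := by positivity
    have h3 : dist (x k) (x (o k)) ≤ n * (2 * (κ * ρ) + d) :=
      h1.trans (mul_le_mul_of_nonneg_right h2 D0)
    rw [e, norm_smul, Real.norm_of_nonneg l1', ← dist_eq_norm, dist_comm, l1]
    refine (mul_le_mul_of_nonneg_left h3 (by positivity)).trans ?_
    rw [div_mul_eq_mul_div, div_le_iff₀ (by positivity)]
    have : 2 * (κ * ρ) + d ≤ κ * (2 * ρ + d) := by nlinarith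
    calc d * (n * (2 * (κ * ρ) + d)) ≤ d * (n * (κ * (2 * ρ + d))) := by gcongr
      _ = _ := by ring

/-- Any family of walls of hard balls is nondegenerate, with a constant that depends only on the
number of balls and the ratios of their radii and masses. -/
theorem nondegenerate_wall {n : ℕ} {R M : Fin n → ℝ} {ρ μ κ : ℝ} (hρ : 0 < ρ) (hμ : 0 < μ)
    (hκ : 0 ≤ κ)
    (hRl : ∀ i, ρ ≤ R i) (hRu : ∀ i, R i ≤ κ * ρ) (hMl : ∀ i, μ ≤ M i) (hMu : ∀ i, M i ≤ κ * μ)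
    (S : Set (Fin n × Fin n)) :
    Nondegenerate (fun p : S => wall R M p) (2 * n * κ * √(n * κ)) := by
  have hM : ∀ i, 0 < M i := fun i => hμ.trans_le (hMl i)
  intro y δ hδ hy
  obtain ⟨x, rfl⟩ := massEmb_surjective hM y
  have hsμ := Real.sqrt_pos.2 hμ
  -- A displacement of mass norm at most `δ` moves each centre by at most `δ / √μ`; the factor `2`
  -- accounts for the two balls of a pair.
  set d : ℝ := 2 * (δ / √μ) with hd
  have d0 : 0 ≤ d := by positivity
  obtain ⟨z, hz, hzx⟩ := exists_shrink hρ hRl hRu (S := S) (x := x) d0 (by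
    intro p hp
    obtain ⟨b, ⟨v, hv, rfl⟩, hb⟩ := hy ⟨p, hp⟩
    have hv : dist (v p.1) (v p.2) ≤ R p.1 + R p.2 := hv
    have near : ∀ k, dist (x k) (v k) ≤ δ / √μ := by
      intro k
      rw [← map_sub] at hb
      have h1 := pow_le_pow_left₀ (norm_nonneg _) hb 2
      rw [norm_massEmb_sq hM] at h1
      have h2 : M k * ‖(x - v) k‖ ^ 2 ≤ ∑ k, M k * ‖(x - v) k‖ ^ 2 :=
        Finset.single_le_sum (f := fun k => M k * ‖(x - v) k‖ ^ 2)
          (fun k _ => mul_nonneg (hM k).le (sq_nonneg _)) (Finset.mem_univ k)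
      have h3 := mul_le_mul_of_nonneg_right (hMl k) (sq_nonneg ‖(x - v) k‖)
      rw [dist_eq_norm, le_div_iff₀ hsμ]
      refine (pow_le_pow_iff_left₀ (by positivity) hδ two_ne_zero).1 ?_
      rw [mul_pow, Real.sq_sqrt hμ.le]
      rw [Pi.sub_apply] at *
      linarith
    have := dist_triangle4 (x p.1) (v p.1) (v p.2) (x p.2)
    have := near p.1
    have := near p.2
    rw [dist_comm] at this
    linarith)
  refine ⟨massEmb M z, fun p => Set.mem_image_of_mem _ (hz p p.2), ?_⟩
  rw [← map_sub]
  refine (pow_le_pow_iff_left₀ (norm_nonneg _) (by positivity) two_ne_zero).1 ?_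
  rw [norm_massEmb_sq hM]
  calc ∑ k, M k * ‖(z - x) k‖ ^ 2 ≤ ∑ k : Fin n, (κ * μ) * (n * κ * d) ^ 2 := by
        refine Finset.sum_le_sum fun k _ => ?_
        exact mul_le_mul (hMu k) (pow_le_pow_left₀ (norm_nonneg _) (hzx k) 2) (by positivity)
          (by positivity)
    _ = _ := by
        rw [Finset.sum_const, Finset.card_univ, Fintype.card_fin, nsmul_eq_mul, hd]
        simp only [mul_pow, div_pow, Real.sq_sqrt hμ.le, Real.sq_sqrt (mul_nonneg n.cast_nonneg hκ)]
        field_simp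

/-- A path which near every time is affine on both sides, with squared speed `c` after it, moves at
most with squared speed `c`. -/
theorem speedLE_of_locally_affine {H : Type*} [NormedAddCommGroup H] [NormedSpace ℝ H]
    {I : Set ℝ} (hI : I.OrdConnected) {X : ℝ → H} {c : ℝ}
    (hX : ∀ t ∈ I, ∃ u w : H, ‖w‖ ^ 2 = c ∧ (∀ᶠ s in 𝓝[<] t, X s = X t + (s - t) • u) ∧
      ∀ᶠ s in 𝓝[>] t, X s = X t + (s - t) • w) : SpeedLE X c I := by
  intro s hs t ht hst
  choose! u w hw hl hr using hX
  have sub : Set.Icc s t ⊆ I := hI.out hs ht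
  have hc0 : 0 ≤ c := by rw [← hw s hs]; positivity
  have hcont : ContinuousOn X (Set.Icc s t) := by
    intro r hr'
    refine ContinuousAt.continuousWithinAt ?_
    rw [continuousAt_iff_continuous_left'_right']
    have lim : ∀ v, ∀ S : Set ℝ, Tendsto (fun s => X r + (s - r) • v) (𝓝[S] r) (𝓝 (X r)) := by
      intro v S
      have : ContinuousAt (fun s : ℝ => X r + (s - r) • v) r := by fun_prop
      simpa [ContinuousAt] using this.tendsto.mono_left (nhdsWithin_le_nhds (s := S))
    exact ⟨(lim _ _).congr' ((hl r (sub hr')).mono fun s hs => hs.symm),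
      (lim _ _).congr' ((hr r (sub hr')).mono fun s hs => hs.symm)⟩
  have hder : ∀ r ∈ Set.Ico s t, HasDerivWithinAt X (w r) (Set.Ici r) r := by
    intro r hr'
    have h1 : HasDerivAt (fun s : ℝ => X r + (s - r) • w r) (w r) r := by
      simpa using (((hasDerivAt_id r).sub_const r).smul_const (w r)).const_add (X r)
    exact hasDerivWithinAt_Ioi_iff_Ici.1 (h1.hasDerivWithinAt.congr_of_eventuallyEq
      (hr r (sub (Set.Ico_subset_Icc_self hr'))) (by simp))
  have hb := norm_image_sub_le_of_norm_deriv_right_le_segment (C := √c) hcont hder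
    (fun r hr' => Real.le_sqrt_of_sq_le (hw r (sub (Set.Ico_subset_Icc_self hr'))).le) t
    (Set.right_mem_Icc.2 hst)
  have := pow_le_pow_left₀ (norm_nonneg _) hb 2
  rwa [mul_pow, Real.sq_sqrt hc0] at this

/-! ### Motions in the mass metric -/

theorem IsMotion.exists_local_law_massEmb {n : ℕ} {R M : Fin n → ℝ} (hR : ∀ i, 0 < R i)
    (hM : ∀ i, 0 < M i) {I : Set ℝ} {a : ℝ → Fin n → Space} (h : IsMotion R M I a) :
    ∃ c, ∀ t ∈ I, ∃ u w : PiLp 2 fun _ : Fin n => Space, ‖u‖ ^ 2 = c ∧ ‖w‖ ^ 2 = c ∧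
      (∀ᶠ s in 𝓝[<] t, massEmb M (a s) = massEmb M (a t) + (s - t) • u) ∧
      (∀ᶠ s in 𝓝[>] t, massEmb M (a s) = massEmb M (a t) + (s - t) • w) ∧
      ∀ z, (∀ p ∈ collidingPairs R I a, z ∈ wall R M p) →
        inner ℝ (massEmb M (a t) - z) u ≤ inner ℝ (massEmb M (a t) - z) w := by
  obtain ⟨c, hc⟩ := h.exists_energy hR hM
  refine ⟨c, fun t ht => ?_⟩
  obtain ⟨u, w, hu, hw, he, hz⟩ := h.exists_local_law hR hM ht
  have hcu := hc t ht u hu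
  refine ⟨massEmb M u, massEmb M w, by rw [norm_massEmb_sq hM, hcu],
    by rw [norm_massEmb_sq hM, he, hcu], ?_, ?_, ?_⟩
  · filter_upwards [hu] with s hs
    rw [← map_smul, ← map_add]
    exact congrArg _ (funext hs)
  · filter_upwards [hw] with s hs
    rw [← map_smul, ← map_add]
    exact congrArg _ (funext hs)
  · intro z hzp
    obtain ⟨z, rfl⟩ := massEmb_surjective hM z
    rw [← map_sub, inner_massEmb hM, inner_massEmb hM]
    exact hz z fun p hp => (massEmb_injective hM).mem_set_image.1 (hzp p hp)

/-- With squared speed `c` the quadratic terms of `‖X - z‖ ^ 2 - c * τ ^ 2` cancel, so the function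
is locally affine on either side of each time, and the collision inequality makes its kinks convex.
-/
theorem IsMotion.exists_speed {n : ℕ} {R M : Fin n → ℝ} (hR : ∀ i, 0 < R i)
    (hM : ∀ i, 0 < M i) {I : Set ℝ} {a : ℝ → Fin n → Space} (h : IsMotion R M I a) :
    ∃ c, SpeedLE (fun t => massEmb M (a t)) c I ∧
      ∀ z, (∀ p : collidingPairs R I a, z ∈ wall R M p) →
        ConvexOn ℝ I fun τ => ‖massEmb M (a τ) - z‖ ^ 2 - c * τ ^ 2 := by
  obtain ⟨c, hc⟩ := h.exists_local_law_massEmb hR hM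
  refine ⟨c, speedLE_of_locally_affine h.ordConnected fun t ht => ?_, fun z hz => convexOn_of_local_kinks h.ordConnected ?_⟩
  · obtain ⟨u, w, -, hw, hl, hr, -⟩ := hc t ht
    exact ⟨u, w, hw, hl, hr⟩
  · intro t ht
    obtain ⟨u, w, hu, hw, hl, hr, hk⟩ := hc t ht
    refine ⟨2 * inner ℝ (massEmb M (a t) - z) u - 2 * c * t,
      2 * inner ℝ (massEmb M (a t) - z) w - 2 * c * t,
      by linarith [hk z fun p hp => hz ⟨p, hp⟩], ?_, ?_⟩
    · filter_upwards [hl] with s hs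
      rw [hs, add_sub_right_comm, norm_add_sq_real, norm_smul, mul_pow, hu, Real.norm_eq_abs,
        sq_abs, inner_smul_right]
      ring
    · filter_upwards [hr] with s hs
      rw [hs, add_sub_right_comm, norm_add_sq_real, norm_smul, mul_pow, hw, Real.norm_eq_abs,
        sq_abs, inner_smul_right]
      ring

/-! ### Counting collisions -/

theorem IsMotion.mono {n : ℕ} {R M : Fin n → ℝ} {I J : Set ℝ} {a : ℝ → Fin n → Space}
    (h : IsMotion R M I a) (hJI : J ⊆ I) (hJ : IsOpen J) (hJ' : J.OrdConnected) :
    IsMotion R M J a :=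
  ⟨hJ, hJ', fun t ht => h.hard t (hJI ht), fun t ht => h.law t (hJI ht)⟩

/-- The times at which balls collide during `I`. -/
def collisionTimes {n : ℕ} (R : Fin n → ℝ) (I : Set ℝ) (a : ℝ → Fin n → Space) : Set ℝ :=
  {t | ∃ p, (t, p) ∈ collisions R I a}

theorem collisions_mono {n : ℕ} (R : Fin n → ℝ) {I J : Set ℝ} (hJI : J ⊆ I)
    (a : ℝ → Fin n → Space) : collisions R J a ⊆ collisions R I a :=
  fun _ h => ⟨hJI h.1, h.2⟩

theorem eq_of_norm_le_norm_midpoint {E : Type*} [NormedAddCommGroup E] [InnerProductSpace ℝ E]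
    {x y : E} {r : ℝ} (hx : ‖x‖ = r) (hy : ‖y‖ = r) (h : 2 * r ≤ ‖x + y‖) : x = y := by
  have p := parallelogram_law_with_norm ℝ x y
  rw [hx, hy] at p
  have r0 : 0 ≤ r := hx ▸ norm_nonneg x
  have : ‖x - y‖ * ‖x - y‖ ≤ 0 := by nlinarith
  rw [← sub_eq_zero, ← norm_eq_zero]
  exact mul_self_eq_zero.1 (le_antisymm this (mul_self_nonneg _))

/-- During a straight uniform motion, two balls collide at most once. -/
theorem IsMotion.not_collide_twice {n : ℕ} {R M : Fin n → ℝ} {I : Set ℝ} {a : ℝ → Fin n → Space}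
    (h : IsMotion R M I a) {x v : Fin n → Space} {t₀ s t p q : ℝ} (hI : Set.Ioo p q ⊆ I)
    (hv : ∀ r ∈ Set.Ioo p q, ∀ k, a r k = x k + (r - t₀) • v k) (hs : s ∈ Set.Ioo p q)
    (ht : t ∈ Set.Ioo p q) (hst : s < t) {e : Fin n × Fin n} (h₁ : (s, e) ∈ collisions R I a)
    (h₂ : (t, e) ∈ collisions R I a) : False := by
  obtain ⟨-, -, touch₁, u, hu, hne⟩ := h₁
  obtain ⟨-, -, touch₂, -⟩ := h₂
  simp only at touch₁ touch₂ hu hne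
  rw [hu.unique (velBefore_of_affine hv hs)] at hne
  have hm : (s + t) / 2 ∈ Set.Ioo p q := ⟨by linarith [hs.1], by linarith [ht.2]⟩
  have hd := h.hard _ (hI hm) e.1 e.2 touch₁.1
  have e₁ := touch₁.2
  have e₂ := touch₂.2
  rw [dist_eq_norm] at e₁ e₂ hd
  have rel : ∀ r ∈ Set.Ioo p q,
      a r e.1 - a r e.2 = (x e.1 - x e.2) + (r - t₀) • (v e.1 - v e.2) := by
    intro r hr
    rw [hv r hr, hv r hr, smul_sub]
    abel
  have hmid : (a s e.1 - a s e.2) + (a t e.1 - a t e.2)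
      = (2 : ℝ) • (a ((s + t) / 2) e.1 - a ((s + t) / 2) e.2) := by
    rw [rel s hs, rel t ht, rel _ hm]
    module
  -- Both relative positions lie on the sphere of radius `R e.1 + R e.2`, and their midpoint, being
  -- that at an intermediate time, is not inside it. By strict convexity they coincide, so the
  -- relative velocity vanishes.
  have heq := eq_of_norm_le_norm_midpoint e₁ e₂ (by
    rw [hmid, norm_smul, Real.norm_ofNat]
    linarith)
  rw [rel s hs, rel t ht] at heq
  have hz : (t - s) • (v e.1 - v e.2) = 0 := by
    have := sub_eq_zero.2 (add_left_cancel heq).symm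
    rw [← sub_smul] at this
    rwa [show t - t₀ - (s - t₀) = t - s by ring] at this
  rcases smul_eq_zero.1 hz with h0 | h0
  · linarith
  · exact hne (sub_eq_zero.1 h0)

theorem exists_strictMono_of_lt_encard {T : Set ℝ} {m : ℕ} (h : (m : ℕ∞) < T.encard) :
    ∃ σ : ℕ → ℝ, StrictMono σ ∧ ∀ l ≤ m, σ l ∈ T := by
  obtain ⟨F, hFT, hF⟩ := Set.exists_subset_encard_eq (Order.add_one_le_of_lt h)
  have hfin : F.Finite := Set.finite_of_encard_eq_coe (k := m + 1) (by rw [hF]; norm_cast)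
  have hcard : hfin.toFinset.card = m + 1 := by
    have := hfin.encard_eq_coe_toFinset_card
    rw [hF] at this
    exact_mod_cast this.symm
  set g := hfin.toFinset.orderEmbOfFin hcard with hg
  have gmem : ∀ i, g i ∈ T := fun i =>
    hFT (hfin.mem_toFinset.1 (Finset.orderEmbOfFin_mem hfin.toFinset hcard i))
  -- Beyond index `m` the sequence grows by unit steps, only to remain strictly increasing on all of
  -- `ℕ`.
  refine ⟨fun l => g (Fin.ofNat (m + 1) (min l m)) + (l - min l m : ℕ), ?_, fun l hl => ?_⟩
  · refine strictMono_nat_of_lt_succ fun l => ?_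
    rcases lt_or_ge l m with hl | hl
    · rw [min_eq_left hl.le, min_eq_left (show l + 1 ≤ m from hl)]
      simp only [Nat.sub_self, Nat.cast_zero, add_zero]
      refine g.strictMono ?_
      rw [Fin.lt_def]
      simp only [Fin.ofNat]
      rw [Nat.mod_eq_of_lt (by omega), Nat.mod_eq_of_lt (by omega)]
      omega
    · rw [min_eq_right hl, min_eq_right (by omega)]
      have : ((l - m : ℕ) : ℝ) < (l + 1 - m : ℕ) := by
        exact_mod_cast (by omega : l - m < l + 1 - m)
      linarith
  · simp only [min_eq_left hl, Nat.sub_self, Nat.cast_zero, add_zero]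
    exact gmem _

/-- Bounds on the ratios of the radii and of the masses. -/
structure Comparable {n : ℕ} (κ : ℝ) (R M : Fin n → ℝ) (ρ μ : ℝ) : Prop where
  radius_pos : 0 < ρ
  mass_pos : 0 < μ
  le_radius : ∀ i, ρ ≤ R i
  radius_le : ∀ i, R i ≤ κ * ρ
  le_mass : ∀ i, μ ≤ M i
  mass_le : ∀ i, M i ≤ κ * μ

/-- The collision times are cut into `L` blocks of `N + 2` steps. The interior of a block contains
`N + 1` collision times, too many for only `k` colliding pairs, so all of the at most `k + 1` pairs
collide there. -/
theorem IsMotion.exists_times_of_many_collisions {n : ℕ} {R M : Fin n → ℝ} {I : Set ℝ}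
    {a : ℝ → Fin n → Space} (h : IsMotion R M I a) {k N L : ℕ}
    (hN : ∀ J, IsMotion R M J a → (collidingPairs R J a).ncard ≤ k →
      (collisionTimes R J a).encard ≤ N)
    (hk : (collidingPairs R I a).ncard ≤ k + 1)
    (hmany : ((L * (N + 2) : ℕ) : ℕ∞) < (collisionTimes R I a).encard) :
    ∃ τ : ℕ → ℝ, StrictMono τ ∧ (∀ l ≤ L, τ l ∈ I) ∧ ∀ l < L,
      (collidingPairs R I a).Nonempty ∧
      ∀ p ∈ collidingPairs R I a, ∃ s ∈ Set.Ioo (τ l) (τ (l + 1)), (s, p) ∈ collisions R I a := by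
  obtain ⟨σ, hσ, hσT⟩ := exists_strictMono_of_lt_encard hmany
  have hσI : ∀ l ≤ L, σ (l * (N + 2)) ∈ I := fun l hl => by
    obtain ⟨p, hp⟩ := hσT (l * (N + 2)) (Nat.mul_le_mul_right _ hl)
    exact hp.1
  refine ⟨fun l => σ (l * (N + 2)), fun l l' hl => hσ (Nat.mul_lt_mul_of_pos_right hl (by omega)),
    hσI, fun l hl => ?_⟩
  set J := Set.Ioo (σ (l * (N + 2))) (σ ((l + 1) * (N + 2))) with hJ
  have hJI : J ⊆ I :=
    Set.Ioo_subset_Icc_self.trans (h.ordConnected.out (hσI l hl.le) (hσI (l + 1) hl))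
  have hcount : ¬ (collisionTimes R J a).encard ≤ N := by
    intro hle
    have hsub : (fun i => σ (l * (N + 2) + i)) '' (Finset.Icc 1 (N + 1) : Finset ℕ)
        ⊆ collisionTimes R J a := by
      rintro _ ⟨i, hi, rfl⟩
      rw [Finset.mem_coe, Finset.mem_Icc] at hi
      have hlN : (l + 1) * (N + 2) ≤ L * (N + 2) := Nat.mul_le_mul_right _ hl
      rw [Nat.add_mul, one_mul] at hlN
      obtain ⟨p, hp⟩ := hσT (l * (N + 2) + i) (by omega)
      refine ⟨p, ⟨hσ (by omega), hσ ?_⟩, hp.2⟩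
      rw [Nat.add_mul, one_mul]
      omega
    have hinj : Function.Injective fun i => σ (l * (N + 2) + i) :=
      hσ.injective.comp (add_right_injective _)
    have hcard := (Set.encard_le_encard hsub).trans hle
    rw [hinj.encard_image, Set.encard_coe_eq_coe_finsetCard, Nat.card_Icc] at hcard
    have : N + 1 + 1 - 1 ≤ N := by exact_mod_cast hcard
    omega
  have hsub : collidingPairs R J a ⊆ collidingPairs R I a :=
    fun p ⟨t, ht⟩ => ⟨t, collisions_mono R hJI a ht⟩
  have hlt : k < (collidingPairs R J a).ncard := by
    by_contra! hle
    exact hcount (hN J (h.mono hJI isOpen_Ioo Set.ordConnected_Ioo) hle)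
  have heq := Set.eq_of_subset_of_ncard_le hsub (hk.trans hlt) (Set.toFinite _)
  rw [← heq]
  refine ⟨Set.nonempty_of_ncard_ne_zero (by omega), ?_⟩
  rintro p ⟨s, hs⟩
  exact ⟨s, hs.1, collisions_mono R hJI a hs⟩

theorem exists_bound_collisionTimes (n : ℕ) {κ : ℝ} (hκ : 0 ≤ κ) (k : ℕ) :
    ∃ N : ℕ, ∀ (R M : Fin n → ℝ) (ρ μ : ℝ), Comparable κ R M ρ μ →
      ∀ (I : Set ℝ) (a : ℝ → Fin n → Space), IsMotion R M I a →
        (collidingPairs R I a).ncard ≤ k → (collisionTimes R I a).encard ≤ N := by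
  induction k with
  | zero =>
    refine ⟨0, fun R M ρ μ _ I a _ hk => ?_⟩
    have h0 : collidingPairs R I a = ∅ := by
      rwa [Nat.le_zero, Set.ncard_eq_zero (Set.toFinite _)] at hk
    have : collisionTimes R I a = ∅ := by
      refine Set.eq_empty_of_forall_notMem ?_
      rintro t ⟨p, hp⟩
      exact (h0 ▸ (⟨t, hp⟩ : p ∈ collidingPairs R I a) : p ∈ (∅ : Set _))
    simp [this]
  | succ k ih =>
    obtain ⟨N, hN⟩ := ih
    -- The nondegeneracy constant is the same for every set of pairs, so `m` depends only on `n` and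
    -- `κ`.
    set C : ℝ := 2 * n * κ * √(n * κ) with hC
    have C0 : 0 ≤ C := by positivity
    obtain ⟨m, hm⟩ := exists_nat_gt (256 * C ^ 2)
    refine ⟨8 * m * (N + 2), fun R M ρ μ hc I a h hk => ?_⟩
    by_contra! hmany
    have hR : ∀ i, 0 < R i := fun i => hc.radius_pos.trans_le (hc.le_radius i)
    have hM : ∀ i, 0 < M i := fun i => hc.mass_pos.trans_le (hc.le_mass i)
    obtain ⟨τ, hτ, hτI, hits⟩ := h.exists_times_of_many_collisions (hN R M ρ μ hc · a) hk hmany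
    obtain ⟨c, hspeed, hconv⟩ := h.exists_speed hR hM
    obtain ⟨l, l', hll', hl', hE⟩ := exists_excess_eq_zero C0
      (nondegenerate_wall hc.radius_pos hc.mass_pos hκ hc.le_radius hc.radius_le hc.le_mass
        hc.mass_le (collidingPairs R I a))
      (fun p => convex_wall R M p) h.ordConnected hspeed hconv hm hτ hτI (by
        rintro l hl ⟨p, hp⟩
        obtain ⟨s, hs, hsp⟩ := (hits l hl).2 p hp
        exact ⟨s, hs, Set.mem_image_of_mem _ (hsp.2.2.1.2.le)⟩)
    have hl8 : l ≤ 8 * m := by omega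
    have hsub : Set.Ioo (τ l) (τ l') ⊆ I :=
      Set.Ioo_subset_Icc_self.trans (h.ordConnected.out (hτI l hl8) (hτI l' hl'))
    obtain ⟨v, hv⟩ := massEmb_surjective hM
      (meanVel (fun t => massEmb M (a t)) (τ l) (τ l'))
    have haff : ∀ r ∈ Set.Ioo (τ l) (τ l'), ∀ k, a r k = a (τ l) k + (r - τ l) • v k := by
      intro r hr k
      have := hspeed.eq_of_excess_eq_zero (hτI l hl8) (hτI l' hl') hE (hsub hr) hr.1 hr.2
      rw [← hv, ← map_smul, ← map_add] at this
      exact congrFun (massEmb_injective hM this) k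
    -- The straight stretch spans at least the blocks `l` and `l + 1`, and the same pair collides in
    -- each of them.
    obtain ⟨p, hp⟩ := (hits l (by omega)).1
    obtain ⟨s, hs, hsp⟩ := (hits l (by omega)).2 p hp
    obtain ⟨t, ht, htp⟩ := (hits (l + 1) (by omega)).2 p hp
    have := hτ.monotone hll'
    have := hτ (Nat.lt_succ_self l)
    have := hτ (Nat.lt_succ_self (l + 1))
    refine h.not_collide_twice hsub haff ⟨hs.1, ?_⟩ ⟨?_, ht.2.trans_le ?_⟩ (hs.2.trans ht.1) hsp htp
    · exact hs.2.trans_le (hτ.monotone (by omega))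
    · linarith [ht.1]
    · exact hτ.monotone hll'

/-- Several pairs may touch at one time, so the bound on the times is multiplied by the number of
pairs. -/
theorem exists_bound_collisions (n : ℕ) {κ : ℝ} (hκ : 0 ≤ κ) :
    ∃ N : ℕ, ∀ (R M : Fin n → ℝ) (ρ μ : ℝ), Comparable κ R M ρ μ →
      ∀ (I : Set ℝ) (a : ℝ → Fin n → Space), IsMotion R M I a →
        (collisions R I a).encard ≤ N := by
  obtain ⟨N, hN⟩ := exists_bound_collisionTimes n hκ (Nat.card (Fin n × Fin n))
  refine ⟨N * Fintype.card (Fin n × Fin n), fun R M ρ μ hc I a h => ?_⟩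
  have hle := hN R M ρ μ hc I a h (Set.ncard_le_card _)
  have hfin : (collisionTimes R I a).Finite :=
    Set.finite_of_encard_le_coe hle
  have hcard : hfin.toFinset.card ≤ N := by
    rw [hfin.encard_eq_coe_toFinset_card] at hle
    exact_mod_cast hle
  have hsub : collisions R I a ⊆ (hfin.toFinset ×ˢ (Finset.univ : Finset (Fin n × Fin n)) :
      Finset (ℝ × Fin n × Fin n)) := by
    rintro ⟨t, p⟩ hp
    exact Finset.mem_coe.2 (Finset.mem_product.2
      ⟨hfin.mem_toFinset.2 ⟨p, hp⟩, Finset.mem_univ p⟩)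
  refine (Set.encard_le_encard hsub).trans ?_
  rw [Set.encard_coe_eq_coe_finsetCard, Finset.card_product, Finset.card_univ]
  exact_mod_cast Nat.mul_le_mul_right _ hcard

theorem exists_pos_bounds {n : ℕ} {R : Fin n → ℝ} (hR : ∀ i, 0 < R i) :
    ∃ ρ κ, 0 < ρ ∧ 0 ≤ κ ∧ (∀ i, ρ ≤ R i) ∧ ∀ i, R i ≤ κ * ρ := by
  rcases isEmpty_or_nonempty (Fin n) with h | h
  · exact ⟨1, 1, one_pos, zero_le_one, fun i => h.elim i, fun i => h.elim i⟩
  obtain ⟨i, hi⟩ := Finite.exists_min R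
  obtain ⟨j, hj⟩ := Finite.exists_max R
  refine ⟨R i, R j / R i, hR i, (div_pos (hR j) (hR i)).le, hi, fun k => ?_⟩
  rw [div_mul_cancel₀ _ (hR i).ne']
  exact hj k

end HardBalls

/-- The number of collisions of `n` hard balls in `ℝ³` is bounded in terms of their radii and
masses only and, for identical balls, in terms of `n` only. -/
theorem mainTheorem3 :
    (∀ (n : ℕ) (R M : Fin n → ℝ), (∀ i, 0 < R i) → (∀ i, 0 < M i) →
      ∃ N : ℕ, ∀ (I : Set ℝ) (a : ℝ → Fin n → HardBalls.Space),
        HardBalls.IsMotion R M I a → (HardBalls.collisions R I a).encard ≤ (N : ℕ∞)) ∧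
    (∀ n : ℕ, ∃ N : ℕ, ∀ r m : ℝ, 0 < r → 0 < m →
      ∀ (I : Set ℝ) (a : ℝ → Fin n → HardBalls.Space),
        HardBalls.IsMotion (fun _ : Fin n => r) (fun _ : Fin n => m) I a →
          (HardBalls.collisions (fun _ : Fin n => r) I a).encard ≤ (N : ℕ∞)) := by
  refine ⟨fun n R M hR hM => ?_, fun n => ?_⟩
  · obtain ⟨ρ, κ₁, hρ, hκ₁, hRl, hRu⟩ := HardBalls.exists_pos_bounds hR
    obtain ⟨μ, κ₂, hμ, -, hMl, hMu⟩ := HardBalls.exists_pos_bounds hM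
    obtain ⟨N, hN⟩ := HardBalls.exists_bound_collisions n (hκ₁.trans (le_max_left κ₁ κ₂))
    exact ⟨N, hN R M ρ μ ⟨hρ, hμ, hRl,
      fun i => (hRu i).trans (mul_le_mul_of_nonneg_right (le_max_left _ _) hρ.le), hMl,
      fun i => (hMu i).trans (mul_le_mul_of_nonneg_right (le_max_right _ _) hμ.le)⟩⟩
  -- Identical balls are comparable with `κ = 1`, whatever their radius and mass, so `N` depends on
  -- `n` alone.
  · obtain ⟨N, hN⟩ := HardBalls.exists_bound_collisions n zero_le_one
    exact ⟨N, fun r m hr hm => hN _ _ r m ⟨hr, hm, fun _ => le_rfl, fun _ => (one_mul r).ge,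
      fun _ => le_rfl, fun _ => (one_mul m).ge⟩⟩
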